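/- Let $d\in\mathbb N$, let $\lambda^d$ be Lebesgue measure on $\mathbb R^d$, and let $\mathcal B_b(\mathbb R^d)$ be the set of bounded Borel subsets of $\mathbb R^d$. A Lévy basis is a family $L=(L(A))_{A\in\mathcal B_b(\mathbb R^d)}$ of real random variables on a probability space such that (i) $L(\bigcup_{n\ge 0} A_n)=\sum_{n=0}^\infty L(A_n)$ a.s. for all pairwise disjoint $A_n\in\mathcal B_b(\mathbb R^d)$ whose union is bounded; (ii) $L(A_1),\dots,L(A_n)$ are independent for all pairwise disjoint $A_1,\dots,A_n\in\mathcal B_b(\mathbb R^d)$ and every $n\in\mathbb N$; (iii) there are $a\ge 0$, $\gamma\in\mathbb R$ and a measure $\nu$ on $\mathbb R$ with $\nu(\{0\})=0$ and $\int_{\mathbb R}\min\{1,x^2\}\,\nu(dx)<\infty$ such that $\mathbb E e^{izL(A)}=\exp(\psi(z)\lambda^d(A))$ for all $A\in\mathcal B_b(\mathbb R^d)$ and $z\in\mathbb R$, where $\psi(z)=i\gamma z-\tfrac12 az^2+\int_{\mathbb R}(e^{ixz}-1-ixz\mathbf 1_{[-1,1]}(x))\,\nu(dx)$. For a simple function $g=\sum_j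 x_j\mathbf 1_{A_j}$ with $x_j\in\mathbb R$, $A_j\in\mathcal B_b(\mathbb R^d)$, and a Borel set $A\subset\mathbb R^d$, put $\int_A g\,dL=\sum_j x_jL(A_j\cap A)$. A Borel function $f:\mathbb R^d\to\mathbb R$ is integrable with respect to $L$ if there are simple functions $g_n\to f$ $\lambda^d$-a.e. such that $\int_A g_n\,dL$ converges in probability for every Borel set $A\subset\mathbb R^d$; the limit is denoted by $\int_A f\,dL$. Let $L$ be a Lévy basis on $\mathbb R^d$ with $\mathbb E L([0,1]^d)^4<\infty$, $\mathbb E L([0,1]^d)=0$ and $\sigma^2:=\mathbb E L([0,1]^d)^2>0$, where $\sigma>0$, and let $\eta:=\sigma^{-4}\,\mathbb E L([0,1]^d)^4$. Let $f_1,\dots,f_4:\mathbb R^d\to\mathbb R$ be Borel functions in $L^2(\mathbb R^d)\cap L^4(\mathbb R^d)$. Then each $f_i$ is integrable with respect to $L$, and for every choice of the integrals $\int_{\mathbb R^d}f_i\,dL$ (that is, for limits obtained from any approximating sequences as above) the product $\prod_{i=1}^4\int_{\mathbb R^d}f_i\,dL$ has finite expectation and $$\begin{aligned}\mathbb E\prod_{i=1}^4\int_{\mathbb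 R^d}f_i\,dL={}&(\eta-3)\sigma^4\int_{\mathbb R^d}f_1f_2f_3f_4\,d\lambda^d+\sigma^4\int_{\mathbb R^d}f_1f_2\,d\lambda^d\int_{\mathbb R^d}f_3f_4\,d\lambda^d\\&+\sigma^4\int_{\mathbb R^d}f_1f_3\,d\lambda^d\int_{\mathbb R^d}f_2f_4\,d\lambda^d+\sigma^4\int_{\mathbb R^d}f_1f_4\,d\lambda^d\int_{\mathbb R^d}f_2f_3\,d\lambda^d.\end{aligned}$$ -/

import Mathlib

open MeasureTheory ProbabilityTheory Filter Topology

namespace LevyNoise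

/-- A measure `ν` on `ℝ` is a Lévy measure if `ν {0} = 0` and `∫ min (1, x²) ν(dx) < ∞`. -/
structure IsLevyMeasure (ν : Measure ℝ) : Prop where
  singleton_zero : ν {0} = 0
  lintegral_lt_top : ∫⁻ x, ENNReal.ofReal (min 1 (x ^ 2)) ∂ν < ⊤

/-- The characteristic exponent of the triplet `(a, ν, γ)`,
`ψ(z) = iγz - az²/2 + ∫ (exp(ixz) - 1 - ixz 1_{[-1,1]}(x)) ν(dx)`. -/
noncomputable def charExponent (a : ℝ) (ν : Measure ℝ) (γ : ℝ) (z : ℝ) : ℂ :=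
  Complex.I * γ * z - (1 / 2 : ℂ) * a * z ^ 2
    + ∫ x : ℝ, (Complex.exp (Complex.I * x * z) - 1
        - (Set.Icc (-1 : ℝ) 1).indicator (fun y : ℝ => Complex.I * y * z) x) ∂ν

/-- `L` is a Lévy basis on `ℝᵈ` over the probability space `(Ω, P)`. Only the values of `L` on
bounded Borel sets matter; its values on other sets are unconstrained. -/
structure IsLevyBasis {d : ℕ} {Ω : Type*} [MeasurableSpace Ω] (P : Measure Ω)
    (L : Set (EuclideanSpace ℝ (Fin d)) → Ω → ℝ) : Prop where
  /-- `L(A)` is a real random variable. -/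
  measurable : ∀ A, MeasurableSet A → Bornology.IsBounded A → Measurable (L A)
  /-- Almost sure countable additivity: the series converges a.s. as a series, i.e. its sequence
  of partial sums converges (absolute convergence is not required). -/
  countably_additive : ∀ A : ℕ → Set (EuclideanSpace ℝ (Fin d)),
    (∀ n, MeasurableSet (A n)) → (∀ n, Bornology.IsBounded (A n)) →
    Pairwise (fun m n => Disjoint (A m) (A n)) → Bornology.IsBounded (⋃ n, A n) →
    ∀ᵐ ω ∂P, Tendsto (fun N => ∑ n ∈ Finset.range N, L (A n) ω) atTop (𝓝 (L (⋃ n, A n) ω))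
  /-- Independence over finitely many pairwise disjoint sets. -/
  indep : ∀ (n : ℕ) (A : Fin n → Set (EuclideanSpace ℝ (Fin d))),
    (∀ i, MeasurableSet (A i)) → (∀ i, Bornology.IsBounded (A i)) →
    Pairwise (fun i j => Disjoint (A i) (A j)) → iIndepFun (fun i => L (A i)) P
  /-- Existence of a characteristic triplet: `E exp(iz L(A)) = exp(ψ(z) λᵈ(A))`. -/
  triplet : ∃ (a : ℝ) (ν : Measure ℝ) (γ : ℝ), 0 ≤ a ∧ IsLevyMeasure ν ∧
    ∀ A, MeasurableSet A → Bornology.IsBounded A → ∀ z : ℝ,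
      ∫ ω, Complex.exp (Complex.I * z * L A ω) ∂P
        = Complex.exp (charExponent a ν γ z * ((volume A).toReal : ℂ))

/-- The unit cube `[0,1]ᵈ`. -/
def unitCube (d : ℕ) : Set (EuclideanSpace ℝ (Fin d)) :=
  {x | ∀ i, x i ∈ Set.Icc (0 : ℝ) 1}

/-- `∫_A g dL = ∑ y · L({g = y} ∩ A)` for a simple function `g`, the sum being over the finitely
many values `y` of `g`. It is used only for `g` of bounded support, so that `{g = y}` is a bounded
Borel set for `y ≠ 0`; the value `y = 0` contributes `0`. -/
noncomputable def simpleIntegral {d : ℕ} {Ω : Type*}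
    (L : Set (EuclideanSpace ℝ (Fin d)) → Ω → ℝ)
    (g : SimpleFunc (EuclideanSpace ℝ (Fin d)) ℝ) (A : Set (EuclideanSpace ℝ (Fin d)))
    (ω : Ω) : ℝ :=
  ∑ y ∈ g.range, y * L (g ⁻¹' {y} ∩ A) ω

/-- The family of random variables `(I A)`, `A` Borel, is (a version of) the indefinite integral
`A ↦ ∫_A f dL`: for some simple functions `gₙ` over bounded Borel sets with `gₙ → f` a.e., the
integrals `∫_A gₙ dL` converge in probability to `I A` for every Borel set `A`. -/
def IsIntegral {d : ℕ} {Ω : Type*} [MeasurableSpace Ω] (P : Measure Ω)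
    (L : Set (EuclideanSpace ℝ (Fin d)) → Ω → ℝ) (f : EuclideanSpace ℝ (Fin d) → ℝ)
    (I : Set (EuclideanSpace ℝ (Fin d)) → Ω → ℝ) : Prop :=
  ∃ g : ℕ → SimpleFunc (EuclideanSpace ℝ (Fin d)) ℝ,
    (∀ n, Bornology.IsBounded (Function.support (g n))) ∧
    (∀ᵐ u ∂(volume : Measure (EuclideanSpace ℝ (Fin d))),
      Tendsto (fun n => g n u) atTop (𝓝 (f u))) ∧
    ∀ A, MeasurableSet A → Measurable (I A) ∧
      TendstoInMeasure P (fun n => simpleIntegral L (g n) A) atTop (I A)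

/-- `f` is integrable with respect to `L`. -/
def IsIntegrable {d : ℕ} {Ω : Type*} [MeasurableSpace Ω] (P : Measure Ω)
    (L : Set (EuclideanSpace ℝ (Fin d)) → Ω → ℝ) (f : EuclideanSpace ℝ (Fin d) → ℝ) : Prop :=
  ∃ I, IsIntegral P L f I

end LevyNoise

namespace LevyNoise

/-! The formula is the polarization of one identity, `E (∫ f dL)^4 = κ ∫ f^4 + 3 σ^4 (∫ f^2)^2`,
where `κ = (η - 3) σ^4` is the fourth cumulant of `L([0,1]^d)`. Applying it to `f₁ ± f₂ ± f₃ ± f₄`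
and summing with signs isolates the mixed terms (`sum_signVec_pow_four`, `sum_signVec_sq_sq`) and
also gives integrability of the product.

The identity expresses that cumulants add over independent summands. The law of `L(A)` has
characteristic function `exp(λ(A) ψ)`, so its cumulants are proportional to `λ(A)`
(`moments_of_charFun_eq_exp`); the fourth moment is finite because a convolution factor inherits
moments (`IsLevyBasis.memLp_four`). Independence over disjoint sets then gives the identity for
simple functions (`IsLevyBasis.integral_simpleIntegral_pow_four`). Hence simple functions converging
in `L² ∩ L⁴` have integrals that are Cauchy in `L⁴(P)`, which yields an integral of `f` and the
identity for it (`IsLevyBasis.exists_isIntegral`).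

An arbitrary approximating sequence converges only a.e. and carries no moment bound, so uniqueness
of the integral needs its own argument (`IsLevyBasis.isIntegral_unique`). If `g n → 0` a.e., a
gliding hump produces a Borel set `A` such that `g n → 0` in `L² ∩ L⁴` on `A` along one subsequence
and on `Aᶜ` along another. The limits over `A` and `Aᶜ` exist by definition, so both vanish. -/

/-! ### The characteristic exponent near `0` -/

lemma charExponent_zero (a : ℝ) (ν : Measure ℝ) (γ : ℝ) : charExponent a ν γ 0 = 0 := by
  simp [charExponent]

/-- The integrand of the Lévy-Khintchine formula is bounded by a multiple of `min 1 x²`. -/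
lemma norm_levyKhintchine_integrand_le {z : ℝ} (hz : |z| ≤ 1) (x : ℝ) :
    ‖Complex.exp (Complex.I * x * z) - 1
        - (Set.Icc (-1 : ℝ) 1).indicator (fun y : ℝ => Complex.I * y * z) x‖
      ≤ 2 * min 1 (x ^ 2) := by
  -- Small jumps use `|exp w - 1 - w| ≤ |w|²`; large ones use `|exp (ixz) - 1| ≤ 2`, the source of
  -- the factor `2`.
  by_cases hx : x ∈ Set.Icc (-1 : ℝ) 1
  · rw [Set.indicator_of_mem hx]
    have hx1 : |x| ≤ 1 := abs_le.2 hx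
    have hn : ‖Complex.I * x * z‖ = |x| * |z| := by simp
    have h1 : ‖Complex.I * x * z‖ ≤ 1 := by
      rw [hn]; exact mul_le_one₀ hx1 (abs_nonneg z) hz
    have h2 := Complex.norm_exp_sub_one_sub_id_le h1
    have h3 : x ^ 2 ≤ 1 := by rw [← sq_abs]; exact pow_le_one₀ (abs_nonneg x) hx1
    have h4 : ‖Complex.I * x * z‖ ^ 2 ≤ x ^ 2 := by
      rw [hn, mul_pow, sq_abs]
      exact mul_le_of_le_one_right (sq_nonneg x) (pow_le_one₀ (abs_nonneg z) hz)
    rw [min_eq_right h3]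
    nlinarith [sq_nonneg x]
  · rw [Set.indicator_of_notMem hx, sub_zero]
    have h1 : 1 < x ^ 2 := by
      rw [one_lt_sq_iff_one_lt_abs]
      by_contra h
      exact hx (abs_le.1 (not_lt.1 h))
    rw [min_eq_left h1.le]
    have h2 : ‖Complex.exp (Complex.I * x * z)‖ = 1 := by
      rw [show Complex.I * x * z = ((x * z : ℝ) : ℂ) * Complex.I by push_cast; ring]
      exact Complex.norm_exp_ofReal_mul_I _
    calc _ ≤ ‖Complex.exp (Complex.I * x * z)‖ + ‖(1 : ℂ)‖ := norm_sub_le _ _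
      _ = 2 * 1 := by rw [h2, norm_one]; norm_num

lemma continuousAt_charExponent_zero (a : ℝ) {ν : Measure ℝ} (hν : IsLevyMeasure ν) (γ : ℝ) :
    ContinuousAt (charExponent a ν γ) 0 := by
  have hint : Integrable (fun x : ℝ => 2 * min 1 (x ^ 2)) ν := by
    refine Integrable.const_mul ⟨by fun_prop, ?_⟩ 2
    rw [hasFiniteIntegral_iff_ofReal (Eventually.of_forall fun x => by positivity)]
    exact hν.lintegral_lt_top
  have hev : ∀ᶠ z : ℝ in 𝓝 0, |z| ≤ 1 := by
    have : Set.Icc (-1 : ℝ) 1 ∈ 𝓝 0 := Icc_mem_nhds (by norm_num) (by norm_num)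
    filter_upwards [this] with z hz using abs_le.2 hz
  unfold charExponent
  refine ContinuousAt.add (by fun_prop) ?_
  refine continuousAt_of_dominated (bound := fun x => 2 * min 1 (x ^ 2)) ?_ ?_ hint ?_
  · refine Eventually.of_forall fun z => Measurable.aestronglyMeasurable ?_
    refine Measurable.sub (by fun_prop) (Measurable.indicator (by fun_prop) measurableSet_Icc)
  · filter_upwards [hev] with z hz
    exact Eventually.of_forall fun x => norm_levyKhintchine_integrand_le hz x
  · refine Eventually.of_forall fun x => ?_
    by_cases hx : x ∈ Set.Icc (-1 : ℝ) 1
    · simp only [Set.indicator_of_mem hx]; fun_prop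
    · simp only [Set.indicator_of_notMem hx]; fun_prop

/-! ### Moments of a power of a characteristic function -/

/-- If the characteristic function of `ρ` is the `t`-th power of that of the centred law `μ`, the
first four moments of `ρ` are those given by scaling the cumulants of `μ` by `t`. -/
lemma moments_of_charFun_eq_exp {μ ρ : Measure ℝ} [IsProbabilityMeasure μ]
    [IsProbabilityMeasure ρ] (hμ : MemLp id 4 μ) (hρ : MemLp id 4 ρ) {ψ : ℝ → ℂ}
    (hψ : ContinuousAt ψ 0) (hψ0 : ψ 0 = 0) (t : ℝ) (h1 : ∀ z, charFun μ z = Complex.exp (ψ z))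
    (h2 : ∀ z, charFun ρ z = Complex.exp (ψ z * t)) (h0 : ∫ x, x ∂μ = 0) :
    ∫ x, x ∂ρ = 0 ∧ ∫ x, x ^ 2 ∂ρ = t * ∫ x, x ^ 2 ∂μ ∧
      ∫ x, x ^ 4 ∂ρ
        = t * (∫ x, x ^ 4 ∂μ - 3 * (∫ x, x ^ 2 ∂μ) ^ 2) + 3 * t ^ 2 * (∫ x, x ^ 2 ∂μ) ^ 2 := by
  have hcμ : ContDiff ℝ 4 (charFun μ) := contDiff_charFun (n := 4) hμ
  have hcρ : ContDiff ℝ 4 (charFun ρ) := contDiff_charFun (n := 4) hρ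
  have hdμ : ContDiff ℝ 3 (deriv (charFun μ)) := (contDiff_succ_iff_deriv (n := 3)).1 hcμ |>.2.2
  have hdρ : ContDiff ℝ 3 (deriv (charFun ρ)) := (contDiff_succ_iff_deriv (n := 3)).1 hcρ |>.2.2
  -- Continuity keeps `Im ψ` in `(-π, π)` near `0`, so the principal logarithm recovers `ψ`, which
  -- thereby inherits differentiability from `charFun μ`.
  have hlog : ∀ᶠ z in 𝓝 (0 : ℝ), ψ z = Complex.log (charFun μ z) := by
    have him : ContinuousAt (fun z => (ψ z).im) 0 := Complex.continuous_im.continuousAt.comp hψ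
    have : Set.Ioo (-Real.pi) Real.pi ∈ 𝓝 ((ψ 0).im) := by
      rw [hψ0]; exact Ioo_mem_nhds (by simp [Real.pi_pos]) (by simp [Real.pi_pos])
    filter_upwards [him this] with z hz
    rw [h1, Complex.log_exp hz.1 hz.2.le]
  have hslit : ∀ᶠ z in 𝓝 (0 : ℝ), charFun μ z ∈ Complex.slitPlane := by
    refine hcμ.continuous.continuousAt.eventually_mem (Complex.isOpen_slitPlane.mem_nhds ?_)
    rw [h1, hψ0]; simp
  -- The logarithmic derivative of `charFun ρ` is `t` times that of `charFun μ`. Cleared of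
  -- denominators, this is accessible to the Leibniz rule, which turns it into relations between
  -- moments.
  have hode : (deriv (charFun ρ) * charFun μ) =ᶠ[𝓝 0]
      fun z => (t : ℂ) * (deriv (charFun μ) * charFun ρ) z := by
    filter_upwards [hlog.eventually_nhds, hslit] with z hz hs
    have hdb : HasDerivAt (charFun μ) (deriv (charFun μ) z) z :=
      (hcμ.differentiable (by norm_num) z).hasDerivAt
    have hdψ : HasDerivAt ψ (deriv (charFun μ) z / charFun μ z) z :=
      (hdb.clog_real hs).congr_of_eventuallyEq hz
    have hda : HasDerivAt (charFun ρ)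
        (Complex.exp (ψ z * t) * (deriv (charFun μ) z / charFun μ z * t)) z := by
      rw [show charFun ρ = fun z => Complex.exp (ψ z * t) from funext h2]
      exact (hdψ.mul_const (t : ℂ)).cexp
    have hne : charFun μ z ≠ 0 := Complex.slitPlane_ne_zero hs
    simp only [Pi.mul_apply]
    rw [hda.deriv, h2]
    field_simp
  have key : ∀ n : ℕ, n ≤ 3 →
      ∑ i ∈ Finset.range (n + 1), (n.choose i : ℂ) * (Complex.I ^ (i + 1) * ∫ x, x ^ (i + 1) ∂ρ)
          * (Complex.I ^ (n - i) * ∫ x, x ^ (n - i) ∂μ)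
        = t * ∑ i ∈ Finset.range (n + 1),
          (n.choose i : ℂ) * (Complex.I ^ (i + 1) * ∫ x, x ^ (i + 1) ∂μ)
          * (Complex.I ^ (n - i) * ∫ x, x ^ (n - i) ∂ρ) := by
    intro n hn
    have hn' : ((n : ℕ∞) : WithTop ℕ∞) ≤ 3 := by
      interval_cases n <;> norm_num
    have hn4 : ((n : ℕ∞) : WithTop ℕ∞) ≤ 4 := hn'.trans (by norm_num)
    have e := hode.iteratedDeriv_eq n
    have hl {κ : Measure ℝ} [IsProbabilityMeasure κ] (hκ : MemLp id 4 κ) {k : ℕ} (hk : k ≤ 4) :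
        iteratedDeriv k (charFun κ) 0 = Complex.I ^ k * ∫ x, x ^ k ∂κ :=
      iteratedDeriv_charFun_zero (hκ.mono_exponent (by exact_mod_cast hk))
    rw [iteratedDeriv_const_mul_field, iteratedDeriv_mul (hdρ.of_le hn').contDiffAt
      (hcμ.of_le hn4).contDiffAt, iteratedDeriv_mul (hdμ.of_le hn').contDiffAt
      (hcρ.of_le hn4).contDiffAt] at e
    convert e using 1
    · refine Finset.sum_congr rfl fun i hi => ?_
      have := Finset.mem_range.1 hi
      rw [← iteratedDeriv_succ', hl hρ (by omega), hl hμ (by omega)]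
    · congr 1
      refine Finset.sum_congr rfl fun i hi => ?_
      have := Finset.mem_range.1 hi
      rw [← iteratedDeriv_succ', hl hρ (by omega), hl hμ (by omega)]
  -- The case `n = 2` is not needed: in `k3` the third moments occur only multiplied by a mean,
  -- which is `0`.
  have k0 := key 0 (by norm_num)
  have k1 := key 1 (by norm_num)
  have k3 := key 3 (by norm_num)
  simp only [Finset.sum_range_succ, Finset.sum_range_zero] at k0 k1 k3
  simp only [zero_add, pow_one, h0, pow_zero, integral_const, probReal_univ, smul_eq_mul,
    Complex.ofReal_zero, Nat.choose, Nat.cast_one, one_mul, mul_one, mul_zero,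
    Nat.sub_self, Complex.ofReal_one] at k0
  have hρ1 : ∫ x, x ∂ρ = 0 := by
    have := (mul_eq_zero.1 k0).resolve_left Complex.I_ne_zero
    exact_mod_cast this
  norm_num [h0, hρ1, Nat.choose] at k1 k3
  have hρ2 : ∫ x, x ^ 2 ∂ρ = t * ∫ x, x ^ 2 ∂μ := by
    exact_mod_cast k1
  refine ⟨hρ1, hρ2, ?_⟩
  rw [hρ2] at k3
  have k3' : ((∫ x, x ^ 4 ∂ρ : ℝ) : ℂ) = ((t * (∫ x, x ^ 4 ∂μ - 3 * (∫ x, x ^ 2 ∂μ) ^ 2)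
      + 3 * t ^ 2 * (∫ x, x ^ 2 ∂μ) ^ 2 : ℝ) : ℂ) := by
    push_cast at k3 ⊢
    linear_combination k3
  exact_mod_cast k3'

/-! ### Boxes of prescribed volume -/

/-- The box `∏ i, [0, b i]`. -/
def box {d : ℕ} (b : Fin d → ℝ) : Set (EuclideanSpace ℝ (Fin d)) :=
  {x | ∀ i, x i ∈ Set.Icc (0 : ℝ) (b i)}

lemma box_eq_preimage {d : ℕ} (b : Fin d → ℝ) :
    box b = WithLp.ofLp ⁻¹' (Set.univ.pi fun i => Set.Icc (0 : ℝ) (b i)) := by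
  ext x; simp [box, Pi.le_def, forall_and]

lemma measurableSet_box {d : ℕ} (b : Fin d → ℝ) : MeasurableSet (box b) := by
  rw [box_eq_preimage]
  exact (PiLp.volume_preserving_ofLp (Fin d)).measurable
    (MeasurableSet.univ_pi fun i => measurableSet_Icc)

lemma volume_box {d : ℕ} (b : Fin d → ℝ) : volume (box b) = ∏ i, ENNReal.ofReal (b i) := by
  rw [box_eq_preimage, (PiLp.volume_preserving_ofLp (Fin d)).measure_preimage
    (MeasurableSet.univ_pi fun i => measurableSet_Icc).nullMeasurableSet, volume_pi_pi]
  simp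

lemma isBounded_box {d : ℕ} (b : Fin d → ℝ) : Bornology.IsBounded (box b) := by
  rw [box_eq_preimage]
  exact (EuclideanSpace.equiv (Fin d) ℝ).antilipschitz.isBounded_preimage
    (Bornology.IsBounded.pi fun i => Metric.isBounded_Icc _ _)

lemma exists_isBounded_volume_eq {d : ℕ} (hd : d ≠ 0) {t : ℝ} (ht : 0 ≤ t) :
    ∃ B : Set (EuclideanSpace ℝ (Fin d)), MeasurableSet B ∧ Bornology.IsBounded B ∧
      (volume B).toReal = t := by
  have : NeZero d := ⟨hd⟩
  refine ⟨box (Function.update 1 0 t), measurableSet_box _, isBounded_box _, ?_⟩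
  rw [volume_box, Finset.prod_eq_single 0 (fun i _ hi => by simp [hi]) (by simp)]
  simp [ht]

lemma unitCube_eq_box (d : ℕ) : unitCube d = box fun _ => 1 := rfl

lemma volume_unitCube (d : ℕ) : volume (unitCube d) = 1 := by
  rw [unitCube_eq_box, volume_box]; simp

/-! ### Moments of `L(A)` -/

lemma memLp_four_iff {α : Type*} [MeasurableSpace α] {μ : Measure α} {f : α → ℝ}
    (hf : AEStronglyMeasurable f μ) : MemLp f 4 μ ↔ Integrable (fun x => f x ^ 4) μ := by
  rw [← integrable_norm_rpow_iff hf (by norm_num) (by norm_num)]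
  have h (x : α) : ‖f x‖ ^ (4 : ENNReal).toReal = f x ^ 4 := by
    rw [ENNReal.toReal_ofNat, Real.rpow_ofNat, Real.norm_eq_abs, Even.pow_abs (by decide)]
  simp_rw [h]

lemma integrable_pow_of_memLp_four {α : Type*} [MeasurableSpace α] {μ : Measure α}
    [IsFiniteMeasure μ] {f : α → ℝ} (hf : MemLp f 4 μ) {k : ℕ} (hk : k ≤ 4) :
    Integrable (fun x => f x ^ k) μ := by
  have h : MemLp f k μ := hf.mono_exponent (by exact_mod_cast hk)
  refine (integrable_norm_iff (hf.1.pow k)).1 ?_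
  simpa using h.integrable_norm_pow'

/-- A summand of a convolution has finite fourth moment as soon as the convolution does. -/
lemma memLp_four_of_memLp_conv {μ ρ : Measure ℝ} [IsProbabilityMeasure μ]
    [IsProbabilityMeasure ρ] (h : MemLp id 4 (μ ∗ ρ)) : MemLp id 4 ρ := by
  have hi : Integrable (fun x : ℝ => ‖x‖ ^ 4) (μ ∗ ρ) := h.integrable_norm_pow' (p := 4)
  rw [integrable_conv_iff (by fun_prop)] at hi
  -- By Fubini `y ↦ |x + y|^4` is `ρ`-integrable for almost every `x`; one such `x` suffices, as a
  -- constant shift does not affect membership in `L⁴`.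
  obtain ⟨x, hx⟩ := hi.1.exists
  have h1 : MemLp (fun y : ℝ => x + y) 4 ρ :=
    (memLp_four_iff (by fun_prop)).2 (by simpa [Even.pow_abs (show Even 4 by decide)] using hx)
  have h2 := h1.sub (memLp_const (μ := ρ) (p := 4) x)
  refine h2.ae_eq (Eventually.of_forall fun y => ?_)
  simp

lemma memLp_four_conv {μ ρ : Measure ℝ} [IsProbabilityMeasure μ]
    [IsProbabilityMeasure ρ] (hμ : MemLp id 4 μ) (hρ : MemLp id 4 ρ) : MemLp id 4 (μ ∗ ρ) := by
  rw [Measure.conv, memLp_map_measure_iff (by fun_prop) (by fun_prop)]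
  exact (hμ.comp_fst ρ).add (hρ.comp_snd μ)

section

variable {d : ℕ} {Ω : Type*} [MeasurableSpace Ω] {P : Measure Ω}
  {L : Set (EuclideanSpace ℝ (Fin d)) → Ω → ℝ}

/-- Isolates all that is used of the Lévy–Khintchine form: continuity of the exponent at `0` and its
vanishing there. -/
lemma IsLevyBasis.exists_charFun_eq (hL : IsLevyBasis P L) :
    ∃ ψ : ℝ → ℂ, ContinuousAt ψ 0 ∧ ψ 0 = 0 ∧ ∀ A, MeasurableSet A → Bornology.IsBounded A →
      ∀ z, charFun (P.map (L A)) z = Complex.exp (ψ z * ((volume A).toReal : ℝ)) := by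
  obtain ⟨a, ν, γ, -, hν, h⟩ := hL.triplet
  refine ⟨charExponent a ν γ, continuousAt_charExponent_zero a hν γ, charExponent_zero a ν γ,
    fun A hA hb z => ?_⟩
  rw [← h A hA hb z, charFun_apply_real, integral_map (hL.measurable A hA hb).aemeasurable
    (by fun_prop)]
  refine integral_congr_ae (Eventually.of_forall fun ω => ?_)
  simp only
  congr 1; ring

/-- The data of a centred Lévy basis with finite fourth moments that enters the moment formulas:
the variance `v` and the fourth cumulant `κ` of `L([0,1]ᵈ)`. -/
structure HasMoments (P : Measure Ω) (L : Set (EuclideanSpace ℝ (Fin d)) → Ω → ℝ) (v κ : ℝ) :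
    Prop where
  memLp : ∀ A, MeasurableSet A → Bornology.IsBounded A → MemLp (L A) 4 P
  mean : ∀ A, MeasurableSet A → Bornology.IsBounded A → ∫ ω, L A ω ∂P = 0
  second : ∀ A, MeasurableSet A → Bornology.IsBounded A →
    ∫ ω, L A ω ^ 2 ∂P = v * (volume A).toReal
  fourth : ∀ A, MeasurableSet A → Bornology.IsBounded A →
    ∫ ω, L A ω ^ 4 ∂P = κ * (volume A).toReal + 3 * v ^ 2 * (volume A).toReal ^ 2

variable [IsProbabilityMeasure P]

/-- The law of `L(A)` depends on `A` only through its volume, so the sets need not be disjoint nor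
`C` their union. -/
lemma IsLevyBasis.map_eq_conv (hL : IsLevyBasis P L) {A B C : Set (EuclideanSpace ℝ (Fin d))}
    (hA : MeasurableSet A) (hA' : Bornology.IsBounded A) (hB : MeasurableSet B)
    (hB' : Bornology.IsBounded B) (hC : MeasurableSet C) (hC' : Bornology.IsBounded C)
    (h : (volume C).toReal = (volume A).toReal + (volume B).toReal) :
    P.map (L C) = P.map (L A) ∗ P.map (L B) := by
  obtain ⟨ψ, -, -, hψ⟩ := hL.exists_charFun_eq
  have := Measure.isProbabilityMeasure_map (μ := P) (hL.measurable A hA hA').aemeasurable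
  have := Measure.isProbabilityMeasure_map (μ := P) (hL.measurable B hB hB').aemeasurable
  have := Measure.isProbabilityMeasure_map (μ := P) (hL.measurable C hC hC').aemeasurable
  refine Measure.ext_of_charFun (funext fun z => ?_)
  rw [charFun_conv, hψ A hA hA', hψ B hB hB', hψ C hC hC', h, ← Complex.exp_add]
  congr 1; push_cast; ring

/-- If `L([0,1]ᵈ)` has a finite fourth moment, so has `L(A)` for every bounded Borel set `A`. -/
lemma IsLevyBasis.memLp_four (hL : IsLevyBasis P L) (h4 : MemLp (L (unitCube d)) 4 P)
    {A : Set (EuclideanSpace ℝ (Fin d))} (hA : MeasurableSet A) (hA' : Bornology.IsBounded A) :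
    MemLp (L A) 4 P := by
  have hiff {B : Set (EuclideanSpace ℝ (Fin d))} (hB : MeasurableSet B)
      (hB' : Bornology.IsBounded B) : MemLp id 4 (P.map (L B)) ↔ MemLp (L B) 4 P :=
    memLp_map_measure_iff (by fun_prop) (hL.measurable B hB hB').aemeasurable
  have hp {B : Set (EuclideanSpace ℝ (Fin d))} (hB : MeasurableSet B)
      (hB' : Bornology.IsBounded B) : IsProbabilityMeasure (P.map (L B)) :=
    Measure.isProbabilityMeasure_map (hL.measurable B hB hB').aemeasurable
  have hsub {A B C : Set (EuclideanSpace ℝ (Fin d))}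
      (hA : MeasurableSet A) (hA' : Bornology.IsBounded A) (hB : MeasurableSet B)
      (hB' : Bornology.IsBounded B) (hC : MeasurableSet C) (hC' : Bornology.IsBounded C)
      (h : (volume C).toReal = (volume A).toReal + (volume B).toReal) (hC4 : MemLp (L C) 4 P) :
      MemLp (L B) 4 P := by
    have := hp hA hA'
    have := hp hB hB'
    rw [← hiff hC hC', hL.map_eq_conv hA hA' hB hB' hC hC' h] at hC4
    exact (hiff hB hB').1 (memLp_four_of_memLp_conv hC4)
  have hadd {A B C : Set (EuclideanSpace ℝ (Fin d))}
      (hA : MeasurableSet A) (hA' : Bornology.IsBounded A) (hB : MeasurableSet B)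
      (hB' : Bornology.IsBounded B) (hC : MeasurableSet C) (hC' : Bornology.IsBounded C)
      (h : (volume C).toReal = (volume A).toReal + (volume B).toReal) (hA4 : MemLp (L A) 4 P)
      (hB4 : MemLp (L B) 4 P) : MemLp (L C) 4 P := by
    have := hp hA hA'
    have := hp hB hB'
    rw [← hiff hC hC', hL.map_eq_conv hA hA' hB hB' hC hC' h]
    exact memLp_four_conv ((hiff hA hA').2 hA4) ((hiff hB hB').2 hB4)
  have hQ : MeasurableSet (unitCube d) := measurableSet_box _
  have hQ' : Bornology.IsBounded (unitCube d) := isBounded_box _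
  have hvQ : (volume (unitCube d)).toReal = 1 := by rw [volume_unitCube]; simp
  have hempty : MemLp (L ∅) 4 P :=
    hsub hQ hQ' .empty Bornology.isBounded_empty hQ hQ' (by simp) h4
  -- For `d = 0` the space is one point and only the volumes `0` and `1` occur, so there are no
  -- boxes of other volumes to compare with.
  rcases eq_or_ne d 0 with rfl | hd
  · rcases Set.eq_empty_or_nonempty A with rfl | hne
    · exact hempty
    · rwa [Subsingleton.eq_univ_of_nonempty hne, ← Set.eq_univ_of_forall (s := unitCube 0)
        fun x i => i.elim0]
  · have hnat (n : ℕ) : ∀ B : Set (EuclideanSpace ℝ (Fin d)), MeasurableSet B →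
        Bornology.IsBounded B → (volume B).toReal = n → MemLp (L B) 4 P := by
      induction n with
      | zero =>
        intro B hB hB' hv
        exact hsub hQ hQ' hB hB' hQ hQ' (by rw [hv]; simp) h4
      | succ n ih =>
        intro B hB hB' hv
        obtain ⟨C, hC, hC', hvC⟩ := exists_isBounded_volume_eq hd (Nat.cast_nonneg (α := ℝ) n)
        exact hadd hC hC' hQ hQ' hB hB' (by rw [hv, hvC, hvQ]; push_cast; ring)
          (ih C hC hC' hvC) h4
    -- Complete the volume of `A` to an integer `n`: the law of `L(A)` is then a convolution factor
    -- of a law with finite fourth moment.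
    obtain ⟨n, hn⟩ := exists_nat_ge (volume A).toReal
    obtain ⟨C, hC, hC', hvC⟩ := exists_isBounded_volume_eq hd (Nat.cast_nonneg (α := ℝ) n)
    obtain ⟨B, hB, hB', hvB⟩ := exists_isBounded_volume_eq hd (sub_nonneg.2 hn)
    exact hsub hB hB' hA hA' hC hC' (by rw [hvC, hvB]; ring) (hnat n C hC hC' hvC)

/-- The unit cube has volume `1`, so the law of `L(A)` is its `λ(A)`-th convolution power in the
sense of characteristic functions. -/
lemma IsLevyBasis.hasMoments (hL : IsLevyBasis P L) (h4 : MemLp (L (unitCube d)) 4 P)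
    (h1 : ∫ ω, L (unitCube d) ω ∂P = 0) :
    HasMoments P L (∫ ω, L (unitCube d) ω ^ 2 ∂P)
      (∫ ω, L (unitCube d) ω ^ 4 ∂P - 3 * (∫ ω, L (unitCube d) ω ^ 2 ∂P) ^ 2) := by
  obtain ⟨ψ, hψ, hψ0, hc⟩ := hL.exists_charFun_eq
  have hQ : MeasurableSet (unitCube d) := measurableSet_box _
  have hQ' : Bornology.IsBounded (unitCube d) := isBounded_box _
  have hmQ := hL.measurable _ hQ hQ'
  have key (A : Set (EuclideanSpace ℝ (Fin d))) (hA : MeasurableSet A)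
      (hA' : Bornology.IsBounded A) := by
    have hm := hL.measurable A hA hA'
    have := Measure.isProbabilityMeasure_map (μ := P) hmQ.aemeasurable
    have := Measure.isProbabilityMeasure_map (μ := P) hm.aemeasurable
    have := moments_of_charFun_eq_exp (μ := P.map (L (unitCube d))) (ρ := P.map (L A))
      ((memLp_map_measure_iff (by fun_prop) hmQ.aemeasurable).2 h4)
      ((memLp_map_measure_iff (by fun_prop) hm.aemeasurable).2 (hL.memLp_four h4 hA hA'))
      hψ hψ0 (volume A).toReal (fun z => by rw [hc _ hQ hQ', volume_unitCube]; simp)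
      (hc A hA hA') (by rwa [integral_map hmQ.aemeasurable (by fun_prop)])
    rwa [integral_map hmQ.aemeasurable (by fun_prop), integral_map hmQ.aemeasurable (by fun_prop),
      integral_map hm.aemeasurable (by fun_prop), integral_map hm.aemeasurable (by fun_prop),
      integral_map hm.aemeasurable (by fun_prop)] at this
  refine ⟨fun A hA hA' => hL.memLp_four h4 hA hA', fun A hA hA' => (key A hA hA').1,
    fun A hA hA' => ?_, fun A hA hA' => ?_⟩
  · rw [(key A hA hA').2.1]; ring
  · rw [(key A hA hA').2.2]; ring

end

/-! ### Moments of independent sums -/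

/-- The second and fourth moments of a sum of two independent centred random variables, given in
terms of the variances and the fourth cumulants. -/
lemma moments_add_of_indepFun {Ω : Type*} [MeasurableSpace Ω] {P : Measure Ω}
    [IsProbabilityMeasure P] {Y Z : Ω → ℝ} (hYZ : IndepFun Y Z P) (hY : MemLp Y 4 P)
    (hZ : MemLp Z 4 P) (hY0 : ∫ ω, Y ω ∂P = 0) (hZ0 : ∫ ω, Z ω ∂P = 0) :
    ∫ ω, (Y ω + Z ω) ^ 2 ∂P = ∫ ω, Y ω ^ 2 ∂P + ∫ ω, Z ω ^ 2 ∂P ∧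
    ∫ ω, (Y ω + Z ω) ^ 4 ∂P
      = ∫ ω, Y ω ^ 4 ∂P + 6 * (∫ ω, Y ω ^ 2 ∂P) * (∫ ω, Z ω ^ 2 ∂P) + ∫ ω, Z ω ^ 4 ∂P := by
  have hind (j k : ℕ) : IndepFun (fun ω => Y ω ^ j) (fun ω => Z ω ^ k) P :=
    hYZ.comp (φ := fun x => x ^ j) (ψ := fun x => x ^ k) (by fun_prop) (by fun_prop)
  have hint {j k : ℕ} (hj : j ≤ 4) (hk : k ≤ 4) : Integrable (fun ω => Y ω ^ j * Z ω ^ k) P :=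
    (hind j k).integrable_mul (integrable_pow_of_memLp_four hY hj)
      (integrable_pow_of_memLp_four hZ hk)
  have hmul (j k : ℕ) : ∫ ω, Y ω ^ j * Z ω ^ k ∂P = (∫ ω, Y ω ^ j ∂P) * ∫ ω, Z ω ^ k ∂P :=
    (hind j k).integral_fun_mul_eq_mul_integral (hY.1.pow j) (hZ.1.pow k)
  have e2 (ω : Ω) : (Y ω + Z ω) ^ 2
      = Y ω ^ 2 * Z ω ^ 0 + 2 * (Y ω ^ 1 * Z ω ^ 1) + Y ω ^ 0 * Z ω ^ 2 := by ring
  have e4 (ω : Ω) : (Y ω + Z ω) ^ 4 = Y ω ^ 4 * Z ω ^ 0 + 4 * (Y ω ^ 3 * Z ω ^ 1)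
      + 6 * (Y ω ^ 2 * Z ω ^ 2) + 4 * (Y ω ^ 1 * Z ω ^ 3) + Y ω ^ 0 * Z ω ^ 4 := by ring
  have h40 := hint (j := 4) (k := 0) (by norm_num) (by norm_num)
  have h31 := (hint (j := 3) (k := 1) (by norm_num) (by norm_num)).const_mul 4
  have h22 := (hint (j := 2) (k := 2) (by norm_num) (by norm_num)).const_mul 6
  have h13 := (hint (j := 1) (k := 3) (by norm_num) (by norm_num)).const_mul 4
  have h04 := hint (j := 0) (k := 4) (by norm_num) (by norm_num)
  have h20 := hint (j := 2) (k := 0) (by norm_num) (by norm_num)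
  have h11 := (hint (j := 1) (k := 1) (by norm_num) (by norm_num)).const_mul 2
  have h02 := hint (j := 0) (k := 2) (by norm_num) (by norm_num)
  constructor
  · simp_rw [e2]
    rw [integral_add (h20.fun_add h11) h02, integral_add h20 h11, integral_const_mul]
    simp only [hmul]
    simp [hY0, hZ0]
  · simp_rw [e4]
    rw [integral_add (((h40.fun_add h31).fun_add h22).fun_add h13) h04,
      integral_add ((h40.fun_add h31).fun_add h22) h13, integral_add (h40.fun_add h31) h22,
      integral_add h40 h31, integral_const_mul, integral_const_mul, integral_const_mul]
    simp only [hmul]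
    simp [hY0, hZ0, mul_assoc]

/-- Here `m` and `k` are the variances and fourth cumulants, both additive over independent centred
summands. -/
lemma moments_sum_of_iIndepFun {Ω ι : Type*} [MeasurableSpace Ω] {P : Measure Ω}
    [IsProbabilityMeasure P] {X : ι → Ω → ℝ} (hX : iIndepFun X P) (hm : ∀ i, Measurable (X i))
    (h4 : ∀ i, MemLp (X i) 4 P) {m k : ι → ℝ} (hmean : ∀ i, ∫ ω, X i ω ∂P = 0)
    (hsecond : ∀ i, ∫ ω, X i ω ^ 2 ∂P = m i)
    (hfourth : ∀ i, ∫ ω, X i ω ^ 4 ∂P = k i + 3 * m i ^ 2) (s : Finset ι) :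
    ∫ ω, (∑ i ∈ s, X i ω) ^ 4 ∂P = ∑ i ∈ s, k i + 3 * (∑ i ∈ s, m i) ^ 2 := by
  classical
  suffices h : ∫ ω, ∑ i ∈ s, X i ω ∂P = 0 ∧ ∫ ω, (∑ i ∈ s, X i ω) ^ 2 ∂P = ∑ i ∈ s, m i ∧
      ∫ ω, (∑ i ∈ s, X i ω) ^ 4 ∂P = ∑ i ∈ s, k i + 3 * (∑ i ∈ s, m i) ^ 2 from h.2.2
  induction s using Finset.induction_on with
  | empty => simp
  | insert i s hi ih =>
    obtain ⟨ih1, ih2, ih4⟩ := ih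
    have hind : IndepFun (fun ω => ∑ j ∈ s, X j ω) (X i) P := by
      have := hX.indepFun_finsetSum_of_notMem hm hi
      rwa [show (∑ j ∈ s, X j) = fun ω => ∑ j ∈ s, X j ω by ext; simp] at this
    have hS : MemLp (fun ω => ∑ j ∈ s, X j ω) 4 P := memLp_finsetSum s fun j _ => h4 j
    obtain ⟨e2, e4⟩ := moments_add_of_indepFun hind hS (h4 i) ih1 (hmean i)
    simp_rw [Finset.sum_insert hi, add_comm (X i _)]
    refine ⟨?_, ?_, ?_⟩
    · rw [integral_add (hS.integrable (by norm_num)) ((h4 i).integrable (by norm_num)), ih1,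
        hmean, add_zero]
    · rw [e2, ih2, hsecond, add_comm]
    · rw [e4, ih2, ih4, hsecond, hfourth]; ring

/-! ### Integrals of simple functions -/

/-- The level set of `0` may be unbounded, where `L` is unconstrained; discarding it leaves only
bounded sets. -/
lemma simpleIntegral_eq_sum_filter {d : ℕ} {Ω : Type*}
    (L : Set (EuclideanSpace ℝ (Fin d)) → Ω → ℝ) (g : SimpleFunc (EuclideanSpace ℝ (Fin d)) ℝ)
    (A : Set (EuclideanSpace ℝ (Fin d))) :
    simpleIntegral L g A = fun ω => ∑ y ∈ g.range.filter (· ≠ 0), y * L (g ⁻¹' {y} ∩ A) ω := by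
  ext ω
  rw [simpleIntegral, Finset.sum_filter_of_ne]
  intro y _ hy h0
  simp [h0] at hy

section

variable {d : ℕ} {Ω : Type*} [MeasurableSpace Ω] {P : Measure Ω}
  {L : Set (EuclideanSpace ℝ (Fin d)) → Ω → ℝ}

/-- Consecutive partial sums of the convergent series `∑ L ∅` differ by the constant `L ∅`, which
must therefore be `0`. -/
lemma IsLevyBasis.empty (hL : IsLevyBasis P L) : L ∅ =ᵐ[P] 0 := by
  have := hL.countably_additive (fun _ => ∅) (fun _ => .empty)
    (fun _ => Bornology.isBounded_empty) (fun _ _ _ => disjoint_bot_left) (by simp)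
  filter_upwards [this] with ω hω
  simp only [Set.iUnion_empty] at hω
  have h1 := (tendsto_add_atTop_iff_nat 1).2 hω
  simp only [Finset.sum_range_succ] at h1
  have h2 := h1.sub hω
  simp only [add_sub_cancel_left, sub_self] at h2
  exact tendsto_nhds_unique tendsto_const_nhds h2

lemma IsLevyBasis.union (hL : IsLevyBasis P L) {A B : Set (EuclideanSpace ℝ (Fin d))}
    (hA : MeasurableSet A) (hA' : Bornology.IsBounded A) (hB : MeasurableSet B)
    (hB' : Bornology.IsBounded B) (hAB : Disjoint A B) :
    L (A ∪ B) =ᵐ[P] fun ω => L A ω + L B ω := by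
  let C : ℕ → Set (EuclideanSpace ℝ (Fin d))
    | 0 => A
    | 1 => B
    | _ + 2 => ∅
  have hU : ⋃ n, C n = A ∪ B := by
    ext x
    simp only [Set.mem_iUnion, Set.mem_union]
    constructor
    · rintro ⟨_ | _ | n, hn⟩
      exacts [Or.inl hn, Or.inr hn, hn.elim]
    · rintro (h | h)
      exacts [⟨0, h⟩, ⟨1, h⟩]
  have hd : Pairwise (fun m n => Disjoint (C m) (C n)) := by
    rintro (_ | _ | m) (_ | _ | n) hmn <;> simp_all [C, hAB.symm]
  have := hL.countably_additive C (by rintro (_ | _ | n); exacts [hA, hB, .empty])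
    (by rintro (_ | _ | n); exacts [hA', hB', Bornology.isBounded_empty]) hd
    (by rw [hU]; exact hA'.union hB')
  rw [hU] at this
  filter_upwards [this, hL.empty] with ω hω h0
  have h1 := (tendsto_add_atTop_iff_nat 2).2 hω
  refine tendsto_nhds_unique h1 (tendsto_const_nhds.congr fun n => ?_)
  rw [Finset.sum_range_succ', Finset.sum_range_succ', Finset.sum_eq_zero fun k _ => h0]
  simp [C, add_comm]

lemma IsLevyBasis.biUnion (hL : IsLevyBasis P L) {β : Type*} (s : Finset β)
    {C : β → Set (EuclideanSpace ℝ (Fin d))} (hC : ∀ b ∈ s, MeasurableSet (C b))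
    (hC' : ∀ b ∈ s, Bornology.IsBounded (C b)) (hd : Pairwise fun b c => Disjoint (C b) (C c)) :
    L (⋃ b ∈ s, C b) =ᵐ[P] fun ω => ∑ b ∈ s, L (C b) ω := by
  classical
  induction s using Finset.induction_on with
  | empty => simp only [Finset.notMem_empty, Set.iUnion_of_empty, Set.iUnion_empty,
      Finset.sum_empty]; exact hL.empty
  | insert b s hb ih =>
    rw [Finset.set_biUnion_insert]
    have hs (c) (hc : c ∈ s) : c ∈ insert b s := Finset.mem_insert_of_mem hc
    have h1 := hL.union (hC b (Finset.mem_insert_self b s)) (hC' b (Finset.mem_insert_self b s))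
      (s.measurableSet_biUnion fun c hc => hC c (hs c hc))
      ((Bornology.isBounded_biUnion_finset s).2 fun c hc => hC' c (hs c hc))
      (Set.disjoint_iUnion₂_right.2 fun c hc => hd fun h => hb (h ▸ hc))
    filter_upwards [h1, ih (fun c hc => hC c (hs c hc)) fun c hc => hC' c (hs c hc)] with ω e1 e2
    rw [e1, e2, Finset.sum_insert hb]

lemma disjoint_preimage_singleton_inter {α β : Type*} (p : α → β) (A : Set α) :
    Pairwise fun b c => Disjoint (p ⁻¹' {b} ∩ A) (p ⁻¹' {c} ∩ A) := by
  intro b c hbc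
  refine Disjoint.mono Set.inter_subset_left Set.inter_subset_left ?_
  exact Disjoint.preimage p (by simpa using hbc)

/-- The integral of a simple function may be computed from any representation. -/
lemma IsLevyBasis.simpleIntegral_map (hL : IsLevyBasis P L) {β : Type*}
    (p : SimpleFunc (EuclideanSpace ℝ (Fin d)) β) (φ : β → ℝ)
    (h : ∀ b, φ b ≠ 0 → Bornology.IsBounded (p ⁻¹' {b})) {A : Set (EuclideanSpace ℝ (Fin d))}
    (hA : MeasurableSet A) :
    simpleIntegral L (p.map φ) A
      =ᵐ[P] fun ω => ∑ b ∈ p.range, φ b * L (p ⁻¹' {b} ∩ A) ω := by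
  classical
  have hterm (y : ℝ) : ∀ᵐ ω ∂P, y * L (p.map φ ⁻¹' {y} ∩ A) ω
      = ∑ b ∈ p.range with φ b = y, φ b * L (p ⁻¹' {b} ∩ A) ω := by
    rcases eq_or_ne y 0 with rfl | hy
    · refine Eventually.of_forall fun ω => ?_
      rw [zero_mul, Finset.sum_eq_zero]
      intro b hb
      rw [(Finset.mem_filter.1 hb).2, zero_mul]
    · have e : p.map φ ⁻¹' {y} ∩ A = ⋃ b ∈ p.range.filter (φ · = y), (p ⁻¹' {b} ∩ A) := by
        ext x; simp only [SimpleFunc.coe_map, Set.mem_inter_iff, Set.mem_preimage,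
          Function.comp_apply, Set.mem_singleton_iff, Finset.mem_filter, Set.mem_iUnion]
        constructor
        · rintro ⟨h1, h2⟩
          exact ⟨p x, ⟨p.mem_range_self x, h1⟩, rfl, h2⟩
        · rintro ⟨b, ⟨-, h1⟩, h2, h3⟩
          exact ⟨h2 ▸ h1, h3⟩
      have := hL.biUnion (p.range.filter (φ · = y)) (C := fun b => p ⁻¹' {b} ∩ A)
        (fun b _ => (p.measurableSet_fiber b).inter hA)
        (fun b hb => (h b (by rw [(Finset.mem_filter.1 hb).2]; exact hy)).subset
          Set.inter_subset_left)
        (disjoint_preimage_singleton_inter p A)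
      rw [e]
      filter_upwards [this] with ω hω
      rw [hω, Finset.mul_sum]
      refine Finset.sum_congr rfl fun b hb => ?_
      rw [(Finset.mem_filter.1 hb).2]
  have hall : ∀ᵐ ω ∂P, ∀ y ∈ (p.map φ).range, y * L (p.map φ ⁻¹' {y} ∩ A) ω
      = ∑ b ∈ p.range with φ b = y, φ b * L (p ⁻¹' {b} ∩ A) ω :=
    (ae_ball_iff (p.map φ).range.countable_toSet).2 fun y _ => hterm y
  filter_upwards [hall] with ω hω
  rw [simpleIntegral, Finset.sum_congr rfl hω, Finset.sum_fiberwise_of_maps_to]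
  intro b hb
  rw [SimpleFunc.range_map]
  exact Finset.mem_image_of_mem φ hb

/-- The linear combination `a g + b h` of two simple functions. -/
noncomputable def linComb {α : Type*} [MeasurableSpace α] (a b : ℝ) (g h : SimpleFunc α ℝ) :
    SimpleFunc α ℝ :=
  (g.pair h).map fun p => a * p.1 + b * p.2

@[simp] lemma linComb_apply {α : Type*} [MeasurableSpace α] (a b : ℝ) (g h : SimpleFunc α ℝ)
    (x : α) : linComb a b g h x = a * g x + b * h x := rfl

lemma isBounded_support_linComb (a b : ℝ) {g h : SimpleFunc (EuclideanSpace ℝ (Fin d)) ℝ}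
    (hg : Bornology.IsBounded (Function.support g)) (hh : Bornology.IsBounded (Function.support h)) :
    Bornology.IsBounded (Function.support (linComb a b g h)) := by
  refine (hg.union hh).subset fun x hx => ?_
  by_contra hn
  simp only [Set.mem_union, Function.mem_support, not_or, not_not] at hn
  simp [hn.1, hn.2] at hx

lemma isBounded_preimage_of_ne_zero {g : SimpleFunc (EuclideanSpace ℝ (Fin d)) ℝ}
    (hg : Bornology.IsBounded (Function.support g)) {y : ℝ} (hy : y ≠ 0) :
    Bornology.IsBounded (g ⁻¹' {y}) :=
  hg.subset fun x hx => by
    rw [Function.mem_support, show g x = y from hx]; exact hy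

lemma IsLevyBasis.simpleIntegral_linComb (hL : IsLevyBasis P L) (a b : ℝ)
    {g h : SimpleFunc (EuclideanSpace ℝ (Fin d)) ℝ}
    (hg : Bornology.IsBounded (Function.support g)) (hh : Bornology.IsBounded (Function.support h))
    {A : Set (EuclideanSpace ℝ (Fin d))} (hA : MeasurableSet A) :
    simpleIntegral L (linComb a b g h) A
      =ᵐ[P] fun ω => a * simpleIntegral L g A ω + b * simpleIntegral L h A ω := by
  -- The pair `(g, h)` is a common refinement of `g`, `h` and their combination. Its only possibly
  -- unbounded fibre is over `(0, 0)`, which all three maps send to `0`.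
  have hbd (q : ℝ × ℝ) (hq : q ≠ 0) : Bornology.IsBounded ((g.pair h) ⁻¹' {q}) := by
    refine (hg.union hh).subset fun x hx => ?_
    by_contra hn
    simp only [Set.mem_union, Function.mem_support, not_or, not_not] at hn
    apply hq
    rw [← show g.pair h x = q from hx, SimpleFunc.pair_apply, hn.1, hn.2]; rfl
  have h1 := hL.simpleIntegral_map (g.pair h) (fun q => a * q.1 + b * q.2)
    (fun q hq => hbd q (by rintro rfl; simp at hq)) hA
  have h2 := hL.simpleIntegral_map (g.pair h) Prod.fst
    (fun q hq => hbd q (by rintro rfl; simp at hq)) hA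
  have h3 := hL.simpleIntegral_map (g.pair h) Prod.snd
    (fun q hq => hbd q (by rintro rfl; simp at hq)) hA
  rw [show (g.pair h).map Prod.fst = g from rfl] at h2
  rw [show (g.pair h).map Prod.snd = h from rfl] at h3
  filter_upwards [h1, h2, h3] with ω e1 e2 e3
  rw [linComb, e1, e2, e3, Finset.mul_sum, Finset.mul_sum, ← Finset.sum_add_distrib]
  exact Finset.sum_congr rfl fun q _ => by ring

lemma IsLevyBasis.simpleIntegral_add_compl (hL : IsLevyBasis P L)
    {g : SimpleFunc (EuclideanSpace ℝ (Fin d)) ℝ}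
    (hg : Bornology.IsBounded (Function.support g))
    {A : Set (EuclideanSpace ℝ (Fin d))} (hA : MeasurableSet A) :
    simpleIntegral L g Set.univ
      =ᵐ[P] fun ω => simpleIntegral L g A ω + simpleIntegral L g Aᶜ ω := by
  have hterm (y : ℝ) : ∀ᵐ ω ∂P, y * L (g ⁻¹' {y} ∩ Set.univ) ω
      = y * L (g ⁻¹' {y} ∩ A) ω + y * L (g ⁻¹' {y} ∩ Aᶜ) ω := by
    rcases eq_or_ne y 0 with rfl | hy
    · simp
    · have hb := isBounded_preimage_of_ne_zero hg hy
      have := hL.union ((g.measurableSet_fiber y).inter hA) (hb.subset Set.inter_subset_left)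
        ((g.measurableSet_fiber y).inter hA.compl) (hb.subset Set.inter_subset_left)
        (disjoint_compl_right.mono Set.inter_subset_right Set.inter_subset_right)
      rw [Set.inter_union_compl] at this
      filter_upwards [this] with ω hω
      rw [Set.inter_univ, hω, mul_add]
  have hall := (ae_ball_iff (μ := P) g.range.countable_toSet).2 fun y _ => hterm y
  filter_upwards [hall] with ω hω
  rw [simpleIntegral, simpleIntegral, simpleIntegral, ← Finset.sum_add_distrib]
  exact Finset.sum_congr rfl hω

lemma IsLevyBasis.measurable_simpleIntegral (hL : IsLevyBasis P L)
    {g : SimpleFunc (EuclideanSpace ℝ (Fin d)) ℝ}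
    (hg : Bornology.IsBounded (Function.support g))
    {A : Set (EuclideanSpace ℝ (Fin d))} (hA : MeasurableSet A) :
    Measurable (simpleIntegral L g A) := by
  rw [simpleIntegral_eq_sum_filter]
  refine Finset.measurable_sum _ fun y hy => Measurable.const_mul ?_ y
  exact hL.measurable _ ((g.measurableSet_fiber y).inter hA)
    ((isBounded_preimage_of_ne_zero hg (Finset.mem_filter.1 hy).2).subset Set.inter_subset_left)

lemma HasMoments.memLp_simpleIntegral {v κ : ℝ} (hM : HasMoments P L v κ)
    {g : SimpleFunc (EuclideanSpace ℝ (Fin d)) ℝ}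
    (hg : Bornology.IsBounded (Function.support g))
    {A : Set (EuclideanSpace ℝ (Fin d))} (hA : MeasurableSet A) :
    MemLp (simpleIntegral L g A) 4 P := by
  rw [simpleIntegral_eq_sum_filter]
  refine memLp_finsetSum _ fun y hy => MemLp.const_mul ?_ y
  exact hM.memLp _ ((g.measurableSet_fiber y).inter hA)
    ((isBounded_preimage_of_ne_zero hg (Finset.mem_filter.1 hy).2).subset Set.inter_subset_left)

lemma integrable_map_of_isBounded_support {g : SimpleFunc (EuclideanSpace ℝ (Fin d)) ℝ}
    (hg : Bornology.IsBounded (Function.support g)) {φ : ℝ → ℝ} (hφ : φ 0 = 0) :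
    Integrable (fun u => φ (g u)) volume := by
  change Integrable (g.map φ) volume
  refine SimpleFunc.integrable_iff.2 fun y hy => lt_of_le_of_lt (measure_mono ?_)
    hg.measure_lt_top
  intro x hx h0
  apply hy
  rw [← show φ (g x) = y from hx, h0, hφ]

lemma setIntegral_map_eq_sum {g : SimpleFunc (EuclideanSpace ℝ (Fin d)) ℝ}
    (hg : Bornology.IsBounded (Function.support g)) {φ : ℝ → ℝ} (hφ : φ 0 = 0)
    {A : Set (EuclideanSpace ℝ (Fin d))} :
    ∫ u in A, φ (g u) = ∑ y ∈ g.range.filter (· ≠ 0), φ y * (volume (g ⁻¹' {y} ∩ A)).toReal := by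
  have hi : Integrable g volume := integrable_map_of_isBounded_support hg (φ := id) rfl
  have h1 := SimpleFunc.map_integral g φ hi.restrict (μ := volume.restrict A) hφ
  rw [SimpleFunc.integral_eq_integral _ (integrable_map_of_isBounded_support hg hφ).restrict] at h1
  rw [show ∫ u in A, φ (g u) = ∫ u in A, g.map φ u from rfl, h1, Finset.sum_filter_of_ne]
  · refine Finset.sum_congr rfl fun y _ => ?_
    rw [Measure.real, Measure.restrict_apply (g.measurableSet_fiber y), smul_eq_mul, mul_comm]
  · intro y _ hy h0
    simp [h0, hφ] at hy

/-- The fourth moment of the integral of a simple function. -/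
lemma IsLevyBasis.integral_simpleIntegral_pow_four [IsProbabilityMeasure P]
    (hL : IsLevyBasis P L) {v κ : ℝ}
    (hM : HasMoments P L v κ) {g : SimpleFunc (EuclideanSpace ℝ (Fin d)) ℝ}
    (hg : Bornology.IsBounded (Function.support g))
    {A : Set (EuclideanSpace ℝ (Fin d))} (hA : MeasurableSet A) :
    ∫ ω, simpleIntegral L g A ω ^ 4 ∂P
      = κ * (∫ u in A, g u ^ 4) + 3 * v ^ 2 * (∫ u in A, g u ^ 2) ^ 2 := by
  set s := g.range.filter (· ≠ 0) with hs
  -- Independence is given for families indexed by `Fin n`, so the nonzero values are enumerated.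
  let e := s.equivFin
  let c : Fin s.card → ℝ := fun i => e.symm i
  let C : Fin s.card → Set (EuclideanSpace ℝ (Fin d)) := fun i => g ⁻¹' {c i} ∩ A
  have hC (i) : MeasurableSet (C i) := (g.measurableSet_fiber _).inter hA
  have hC' (i) : Bornology.IsBounded (C i) :=
    (isBounded_preimage_of_ne_zero hg (Finset.mem_filter.1 (e.symm i).2).2).subset
      Set.inter_subset_left
  have hd : Pairwise fun i j => Disjoint (C i) (C j) := fun i j hij =>
    disjoint_preimage_singleton_inter g A
      fun h => hij (e.symm.injective (Subtype.ext h))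
  have hsum (F : ℝ → ℝ) : ∑ y ∈ s, F y = ∑ i, F (c i) := by
    rw [← Finset.sum_coe_sort s]
    exact (Equiv.sum_comp e.symm fun y : s => F y).symm
  have hind : iIndepFun (fun i ω => c i * L (C i) ω) P :=
    (hL.indep _ C hC hC' hd).comp (fun i x => c i * x) fun i => measurable_const_mul _
  have key := moments_sum_of_iIndepFun hind
    (fun i => (hL.measurable _ (hC i) (hC' i)).const_mul _)
    (fun i => (hM.memLp _ (hC i) (hC' i)).const_mul _)
    (m := fun i => c i ^ 2 * (v * (volume (C i)).toReal))
    (k := fun i => c i ^ 4 * (κ * (volume (C i)).toReal))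
    (fun i => by rw [integral_const_mul, hM.mean _ (hC i) (hC' i), mul_zero])
    (fun i => by
      simp_rw [mul_pow]
      rw [integral_const_mul, hM.second _ (hC i) (hC' i)])
    (fun i => by
      simp_rw [mul_pow]
      rw [integral_const_mul, hM.fourth _ (hC i) (hC' i)]; ring) Finset.univ
  rw [simpleIntegral_eq_sum_filter, setIntegral_map_eq_sum hg (φ := fun y => y ^ 4) (by simp),
    setIntegral_map_eq_sum hg (φ := fun y => y ^ 2) (by simp), ← hs]
  simp_rw [hsum]
  rw [key, Finset.mul_sum, show 3 * v ^ 2 * (∑ i, c i ^ 2 * (volume (g ⁻¹' {c i} ∩ A)).toReal) ^ 2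
    = 3 * (v * ∑ i, c i ^ 2 * (volume (g ⁻¹' {c i} ∩ A)).toReal) ^ 2 by ring, Finset.mul_sum]
  congr 1
  · exact Finset.sum_congr rfl fun i _ => by simp only [C]; ring
  · congr 2
    exact Finset.sum_congr rfl fun i _ => by simp only [C]; ring

end

/-! ### The gliding hump -/

/-- A gliding hump: if integrable functions `w n ≥ 0` tend to `0` a.e., there is a set `A` such that
`∫_A w n` and `∫_{Aᶜ} w n` each tend to `0` along some subsequence. -/
lemma exists_measurableSet_tendsto_setIntegral {α : Type*} [MeasurableSpace α] {μ : Measure α}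
    [SigmaFinite μ] {w : ℕ → α → ℝ} (hm : ∀ n, Measurable (w n)) (h0 : ∀ n x, 0 ≤ w n x)
    (hi : ∀ n, Integrable (w n) μ) (hlim : ∀ᵐ x ∂μ, Tendsto (fun n => w n x) atTop (𝓝 0)) :
    ∃ A, MeasurableSet A ∧ ∃ φ ψ : ℕ → ℕ, Tendsto φ atTop atTop ∧ Tendsto ψ atTop atTop ∧
      Tendsto (fun k => ∫ x in A, w (φ k) x ∂μ) atTop (𝓝 0) ∧
      Tendsto (fun k => ∫ x in Aᶜ, w (ψ k) x ∂μ) atTop (𝓝 0) := by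
  -- The `E j` have finite measure and exhaust the space up to a null set, and the `w n` with `n ≥
  -- j` are bounded by `1` on `E j`, so dominated convergence applies there.
  let E : ℕ → Set α := fun j => spanningSets μ j ∩ {x | ∀ n, j ≤ n → w n x ≤ 1}
  have hE (j) : MeasurableSet (E j) := by
    refine (measurableSet_spanningSets μ j).inter ?_
    simp only [Set.ofPred_forall]
    exact .iInter fun n => .iInter fun _ => measurableSet_le (hm n) measurable_const
  have hEmono : Monotone E := fun i j hij => Set.inter_subset_inter
    (monotone_spanningSets μ hij) fun x hx n hn => hx n (hij.trans hn)
  have hEnull : μ (⋂ j, (E j)ᶜ) = 0 := by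
    refine measure_mono_null (fun x hx => ?_) (ae_iff.1 hlim)
    intro hx'
    obtain ⟨j, hj⟩ := eventually_atTop.1 (hx'.eventually (eventually_le_nhds one_pos))
    obtain ⟨i, hi⟩ := Set.mem_iUnion.1 ((iUnion_spanningSets μ).symm ▸ Set.mem_univ x)
    refine Set.mem_iInter.1 hx (max i j) ⟨monotone_spanningSets μ (le_max_left i j) hi, ?_⟩
    exact fun n hn => hj n ((le_max_right i j).trans hn)
  have hN (k j : ℕ) : ∃ n ≥ k, ∫ x in E j, w n x ∂μ < 1 / ((k : ℝ) + 1) := by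
    have hfin : μ (E j) < ⊤ :=
      (measure_mono Set.inter_subset_left).trans_lt (measure_spanningSets_lt_top μ j)
    have : Tendsto (fun n => ∫ x in E j, w n x ∂μ) atTop (𝓝 (∫ x in E j, (0 : ℝ) ∂μ)) := by
      refine tendsto_integral_filter_of_dominated_convergence (fun _ => 1)
        (Eventually.of_forall fun n => (hm n).aestronglyMeasurable) ?_
        (integrableOn_const hfin.ne) (ae_restrict_of_ae hlim)
      filter_upwards [eventually_ge_atTop j] with n hn
      filter_upwards [ae_restrict_mem (hE j)] with x hx
      rw [Real.norm_of_nonneg (h0 n x)]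
      exact hx.2 n hn
    rw [integral_zero] at this
    obtain ⟨n, h1, h2⟩ := ((eventually_ge_atTop k).and
      (this.eventually (gt_mem_nhds Nat.one_div_pos_of_nat))).exists
    exact ⟨n, h1, h2⟩
  have hJ (k n j : ℕ) : ∃ i ≥ j, ∫ x in (E i)ᶜ, w n x ∂μ < 1 / ((k : ℝ) + 1) := by
    have := tendsto_setIntegral_of_antitone (μ := μ) (f := w n) (s := fun i => (E i)ᶜ)
      (fun i => (hE i).compl) (fun i j hij => Set.compl_subset_compl.2 (hEmono hij))
      ⟨0, (hi n).integrableOn⟩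
    rw [setIntegral_measure_zero _ hEnull] at this
    obtain ⟨i, h1, h2⟩ := ((eventually_ge_atTop j).and
      (this.eventually (gt_mem_nhds Nat.one_div_pos_of_nat))).exists
    exact ⟨i, h1, h2⟩
  choose N hNk hNi using hN
  choose J hJj hJi using hJ
  -- Alternate choices: `n k` makes `w (n k)` small on `E (j k)`, then `j (k + 1)` makes it small
  -- off `E (j (k + 1))`. Its mass is left on the ring `R k`.
  let j : ℕ → ℕ := fun k => Nat.rec 0 (fun k i => J k (N k i) i) k
  let n : ℕ → ℕ := fun k => N k (j k)
  have hjs (k) : j (k + 1) = J k (n k) (j k) := rfl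
  have hjmono : Monotone j := monotone_nat_of_le_succ fun k => hJj k (n k) (j k)
  let R : ℕ → Set α := fun k => E (j (k + 1)) \ E (j k)
  have hR (k) : MeasurableSet (R k) := (hE _).diff (hE _)
  have hRd {k l : ℕ} (hkl : k < l) : Disjoint (R k) (R l) :=
    Set.disjoint_left.2 fun x hx hx' => hx'.2 (hEmono (hjmono (Nat.succ_le_of_lt hkl)) hx.1)
  have hRd' {k l : ℕ} (hkl : k ≠ l) : Disjoint (R k) (R l) :=
    (lt_or_gt_of_ne hkl).elim hRd fun h => (hRd h).symm
  have hsmall (k : ℕ) {A : Set α} (hA : Disjoint A (R k)) :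
      ∫ x in A, w (n k) x ∂μ ≤ 2 * (1 / ((k : ℝ) + 1)) := by
    have hsub : A ⊆ E (j k) ∪ (E (j (k + 1)))ᶜ := fun x hx => by
      by_contra hn
      simp only [Set.mem_union, Set.mem_compl_iff, not_or, not_not] at hn
      exact Set.disjoint_left.1 hA hx ⟨hn.2, hn.1⟩
    calc ∫ x in A, w (n k) x ∂μ ≤ ∫ x in E (j k) ∪ (E (j (k + 1)))ᶜ, w (n k) x ∂μ :=
          setIntegral_mono_set (hi _).integrableOn (Eventually.of_forall fun x => h0 _ x)
            (Eventually.of_forall hsub)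
      _ = ∫ x in E (j k), w (n k) x ∂μ + ∫ x in (E (j (k + 1)))ᶜ, w (n k) x ∂μ :=
          setIntegral_union (Set.disjoint_compl_right_iff_subset.2 (hEmono (hjmono k.le_succ)))
            (hE _).compl (hi _).integrableOn (hi _).integrableOn
      _ ≤ 2 * (1 / ((k : ℝ) + 1)) := by
          have h1 := hNi k (j k)
          have h2 := hJi k (n k) (j k)
          rw [← hjs] at h2
          change ∫ x in E (j k), w (n k) x ∂μ < _ at h1
          linarith
  have hntop : Tendsto n atTop atTop := tendsto_atTop_mono (fun k => hNk k (j k)) tendsto_id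
  have hφ : Tendsto (fun k : ℕ => 2 * k + 1) atTop atTop :=
    tendsto_atTop_mono (fun k => show k ≤ _ by omega) tendsto_id
  have hψ : Tendsto (fun k : ℕ => 2 * k) atTop atTop :=
    tendsto_atTop_mono (fun k => show k ≤ _ by omega) tendsto_id
  have hz : Tendsto (fun k : ℕ => 2 * (1 / ((k : ℝ) + 1))) atTop (𝓝 0) := by
    simpa using (tendsto_one_div_add_atTop_nhds_zero_nat (𝕜 := ℝ)).const_mul 2
  -- `A` collects the even rings: it misses the humps of odd index, and its complement misses those
  -- of even index.
  refine ⟨⋃ m, R (2 * m), .iUnion fun m => hR _, fun k => n (2 * k + 1), fun k => n (2 * k),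
    hntop.comp hφ, hntop.comp hψ, ?_, ?_⟩
  · refine squeeze_zero (fun k => integral_nonneg fun x => h0 _ x) (fun k => hsmall (2 * k + 1) ?_)
      (hz.comp hφ)
    exact Set.disjoint_iUnion_left.2 fun m => hRd' (by omega)
  · refine squeeze_zero (fun k => integral_nonneg fun x => h0 _ x) (fun k => hsmall (2 * k) ?_)
      (hz.comp hψ)
    exact Set.disjoint_left.2 fun x hx hx' => hx (Set.mem_iUnion.2 ⟨k, hx'⟩)

/-! ### Convergence in measure and in `L⁴` -/

lemma tendstoInMeasure_linComb {Ω : Type*} [MeasurableSpace Ω] {P : Measure Ω}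
    [IsFiniteMeasure P] (a b : ℝ) {X Y : ℕ → Ω → ℝ} {x y : Ω → ℝ} (hXm : ∀ n, Measurable (X n))
    (hYm : ∀ n, Measurable (Y n)) (hX : TendstoInMeasure P X atTop x)
    (hY : TendstoInMeasure P Y atTop y) :
    TendstoInMeasure P (fun n ω => a * X n ω + b * Y n ω) atTop
      (fun ω => a * x ω + b * y ω) := by
  refine (exists_seq_tendstoInMeasure_atTop_iff fun n => Measurable.aestronglyMeasurable
    (((hXm n).const_mul a).add ((hYm n).const_mul b))).2 fun ns hns => ?_
  obtain ⟨k, hk, hk'⟩ := (hX.comp hns.tendsto_atTop).exists_seq_tendsto_ae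
  obtain ⟨l, hl, hl'⟩ := ((hY.comp hns.tendsto_atTop).comp hk.tendsto_atTop).exists_seq_tendsto_ae
  refine ⟨k ∘ l, hk.comp hl, ?_⟩
  filter_upwards [hk', hl'] with ω h1 h2
  exact ((h1.comp hl.tendsto_atTop).const_mul a).add (h2.const_mul b)

lemma eLpNorm_four_eq {α : Type*} [MeasurableSpace α] {μ : Measure α} {f : α → ℝ}
    (hf : MemLp f 4 μ) :
    eLpNorm f 4 μ = ENNReal.ofReal ((∫ x, f x ^ 4 ∂μ) ^ (4⁻¹ : ℝ)) := by
  rw [hf.eLpNorm_eq_integral_rpow_norm (by norm_num) (by norm_num)]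
  have h (x : α) : ‖f x‖ ^ (4 : ENNReal).toReal = f x ^ 4 := by
    rw [ENNReal.toReal_ofNat, Real.rpow_ofNat, Real.norm_eq_abs, Even.pow_abs (by decide)]
  simp_rw [h, ENNReal.toReal_ofNat]

lemma tendsto_eLpNorm_four_zero {α ι : Type*} [MeasurableSpace α] {μ : Measure α}
    {X : ι → α → ℝ} {l : Filter ι} (hX : ∀ n, MemLp (X n) 4 μ)
    (h : Tendsto (fun n => ∫ x, X n x ^ 4 ∂μ) l (𝓝 0)) :
    Tendsto (fun n => eLpNorm (X n) 4 μ) l (𝓝 0) := by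
  simp_rw [fun n => eLpNorm_four_eq (hX n)]
  have := ENNReal.tendsto_ofReal (h.rpow_const (p := (4⁻¹ : ℝ)) (Or.inr (by norm_num)))
  simpa using this

lemma norm_toLp_four_pow {α : Type*} [MeasurableSpace α] {μ : Measure α} {f : α → ℝ}
    (hf : MemLp f 4 μ) : ‖hf.toLp f‖ ^ 4 = ∫ x, f x ^ 4 ∂μ := by
  have h0 : 0 ≤ ∫ x, f x ^ 4 ∂μ := integral_nonneg fun x => by positivity
  rw [Lp.norm_toLp, eLpNorm_four_eq hf, ENNReal.toReal_ofReal (by positivity),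
    ← Real.rpow_natCast, ← Real.rpow_mul h0]
  norm_num

/-! ### Linearity, uniqueness and existence of the integral -/

section

variable {d : ℕ} {Ω : Type*} [MeasurableSpace Ω] {P : Measure Ω} [IsProbabilityMeasure P]
  {L : Set (EuclideanSpace ℝ (Fin d)) → Ω → ℝ}

lemma IsLevyBasis.isIntegral_linComb (hL : IsLevyBasis P L) (a b : ℝ)
    {f f' : EuclideanSpace ℝ (Fin d) → ℝ} {I I' : Set (EuclideanSpace ℝ (Fin d)) → Ω → ℝ}
    (h : IsIntegral P L f I) (h' : IsIntegral P L f' I') :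
    IsIntegral P L (fun u => a * f u + b * f' u) (fun A ω => a * I A ω + b * I' A ω) := by
  obtain ⟨g, hg, hgf, hgI⟩ := h
  obtain ⟨g', hg', hgf', hgI'⟩ := h'
  refine ⟨fun n => linComb a b (g n) (g' n), fun n => isBounded_support_linComb a b (hg n) (hg' n),
    ?_, fun A hA => ⟨((hgI A hA).1.const_mul a).add ((hgI' A hA).1.const_mul b), ?_⟩⟩
  · filter_upwards [hgf, hgf'] with u h1 h2
    exact (h1.const_mul a).add (h2.const_mul b)
  · refine (tendstoInMeasure_linComb a b (fun n => hL.measurable_simpleIntegral (hg n) hA)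
      (fun n => hL.measurable_simpleIntegral (hg' n) hA) (hgI A hA).2 (hgI' A hA).2).congr_left
      fun n => (hL.simpleIntegral_linComb a b (hg n) (hg' n) hA).symm

lemma IsLevyBasis.isIntegral_univ_ae_eq (hL : IsLevyBasis P L)
    {f : EuclideanSpace ℝ (Fin d) → ℝ} {I : Set (EuclideanSpace ℝ (Fin d)) → Ω → ℝ}
    (h : IsIntegral P L f I) {A : Set (EuclideanSpace ℝ (Fin d))} (hA : MeasurableSet A) :
    I Set.univ =ᵐ[P] fun ω => I A ω + I Aᶜ ω := by
  obtain ⟨g, hg, -, hgI⟩ := h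
  have h1 := tendstoInMeasure_linComb 1 1 (fun n => hL.measurable_simpleIntegral (hg n) hA)
    (fun n => hL.measurable_simpleIntegral (hg n) hA.compl) (hgI A hA).2 (hgI Aᶜ hA.compl).2
  simp only [one_mul] at h1
  exact tendstoInMeasure_ae_unique (hgI Set.univ .univ).2
    (h1.congr_left fun n => (hL.simpleIntegral_add_compl (hg n) hA).symm)

/-- The integrals of simple functions along a sequence tending to `0` in `L² ∩ L⁴` tend to `0`. -/
lemma IsLevyBasis.tendstoInMeasure_simpleIntegral_zero (hL : IsLevyBasis P L) {v κ : ℝ}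
    (hM : HasMoments P L v κ) {g : ℕ → SimpleFunc (EuclideanSpace ℝ (Fin d)) ℝ}
    (hg : ∀ n, Bornology.IsBounded (Function.support (g n)))
    {A : Set (EuclideanSpace ℝ (Fin d))} (hA : MeasurableSet A)
    (h2 : Tendsto (fun n => ∫ u in A, g n u ^ 2) atTop (𝓝 0))
    (h4 : Tendsto (fun n => ∫ u in A, g n u ^ 4) atTop (𝓝 0)) :
    TendstoInMeasure P (fun n => simpleIntegral L (g n) A) atTop 0 := by
  have hmem n := hM.memLp_simpleIntegral (hg n) hA
  refine tendstoInMeasure_of_tendsto_eLpNorm (p := 4) (by norm_num) (fun n => (hmem n).1)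
    aestronglyMeasurable_zero ?_
  simp only [sub_zero]
  refine tendsto_eLpNorm_four_zero hmem ?_
  simp_rw [fun n => hL.integral_simpleIntegral_pow_four hM (hg n) hA]
  simpa using (h4.const_mul κ).add ((h2.pow 2).const_mul (3 * v ^ 2))

/-- Two integrals of the same function agree almost surely. -/
lemma IsLevyBasis.isIntegral_unique (hL : IsLevyBasis P L) {v κ : ℝ}
    (hM : HasMoments P L v κ) {f : EuclideanSpace ℝ (Fin d) → ℝ}
    {I J : Set (EuclideanSpace ℝ (Fin d)) → Ω → ℝ} (hI : IsIntegral P L f I)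
    (hJ : IsIntegral P L f J) : I Set.univ =ᵐ[P] J Set.univ := by
  have hIJ := hL.isIntegral_linComb 1 (-1) hI hJ
  have hsplit {A} (hA : MeasurableSet A) := hL.isIntegral_univ_ae_eq hIJ (A := A) hA
  obtain ⟨g, hg, hgf, hgI⟩ := hIJ
  have hi2 (n) : Integrable (fun u => g n u ^ 2) volume :=
    integrable_map_of_isBounded_support (hg n) (φ := fun y => y ^ 2) (by simp)
  have hi4 (n) : Integrable (fun u => g n u ^ 4) volume :=
    integrable_map_of_isBounded_support (hg n) (φ := fun y => y ^ 4) (by simp)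
  -- Using `g² + g⁴` makes a single set `A` control both norms in the fourth moment formula.
  obtain ⟨A, hA, φ, ψ, hφ, hψ, hAφ, hAψ⟩ := exists_measurableSet_tendsto_setIntegral
    (μ := (volume : Measure (EuclideanSpace ℝ (Fin d)))) (w := fun n u => g n u ^ 2 + g n u ^ 4)
    (fun n => ((g n).measurable.pow_const 2).add ((g n).measurable.pow_const 4))
    (fun n u => by positivity) (fun n => (hi2 n).add (hi4 n)) (by
      filter_upwards [hgf] with u hu
      have hu' : Tendsto (fun n => g n u) atTop (𝓝 0) := by simpa using hu
      simpa using (hu'.pow 2).add (hu'.pow 4))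
  have hzero {B : Set (EuclideanSpace ℝ (Fin d))} (hB : MeasurableSet B) {χ : ℕ → ℕ}
      (hχ : Tendsto χ atTop atTop)
      (h : Tendsto (fun k => ∫ u in B, (g (χ k) u ^ 2 + g (χ k) u ^ 4)) atTop (𝓝 0)) :
      (fun ω => 1 * I B ω + -1 * J B ω) =ᵐ[P] 0 := by
    refine tendstoInMeasure_ae_unique ((hgI B hB).2.comp hχ)
      (hL.tendstoInMeasure_simpleIntegral_zero hM (fun k => hg (χ k)) hB ?_ ?_)
    · refine squeeze_zero (fun k => integral_nonneg fun u => by positivity) (fun k => ?_) h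
      exact integral_mono (hi2 _).restrict ((hi2 _).add (hi4 _)).restrict
        fun u => le_add_of_nonneg_right (by positivity)
    · refine squeeze_zero (fun k => integral_nonneg fun u => by positivity) (fun k => ?_) h
      exact integral_mono (hi4 _).restrict ((hi2 _).add (hi4 _)).restrict
        fun u => le_add_of_nonneg_left (by positivity)
  filter_upwards [hsplit hA, hzero hA hφ hAφ, hzero hA.compl hψ hAψ] with ω e1 e2 e3
  simp only [Pi.zero_apply] at e2 e3
  linarith

/-- Domination by `2 |f|` gives convergence in `L²` and `L⁴` at once. The factor `2` arises because
the approximant is no farther from `f u` than `0` is; cutting off to balls bounds the support. -/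
lemma exists_simpleFunc_tendsto {f : EuclideanSpace ℝ (Fin d) → ℝ} (hf : Measurable f) :
    ∃ g : ℕ → SimpleFunc (EuclideanSpace ℝ (Fin d)) ℝ,
      (∀ n, Bornology.IsBounded (Function.support (g n))) ∧
      (∀ u, Tendsto (fun n => g n u) atTop (𝓝 (f u))) ∧ ∀ n u, |g n u| ≤ 2 * |f u| := by
  have hB (n : ℕ) : MeasurableSet (Metric.closedBall (0 : EuclideanSpace ℝ (Fin d)) n) :=
    Metric.isClosed_closedBall.measurableSet
  let a := SimpleFunc.approxOn f hf Set.univ 0 (Set.mem_univ 0)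
  have ha (n u) : |a n u| ≤ 2 * |f u| := by
    have := SimpleFunc.norm_approxOn_zero_le hf (Set.mem_univ (0 : ℝ)) u n
    rwa [← two_mul] at this
  refine ⟨fun n => (a n).restrict (Metric.closedBall 0 n), fun n => ?_, fun u => ?_, fun n u => ?_⟩
  · refine (Metric.isBounded_closedBall (x := 0) (r := (n : ℝ))).subset fun u hu => ?_
    by_contra hn
    rw [Function.mem_support, SimpleFunc.restrict_apply _ (hB n), Set.indicator_of_notMem hn] at hu
    exact hu rfl
  · have h1 : Tendsto (fun n => a n u) atTop (𝓝 (f u)) :=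
      SimpleFunc.tendsto_approxOn hf (Set.mem_univ 0) (by simp)
    refine h1.congr' ?_
    obtain ⟨N, hN⟩ := exists_nat_ge ‖u‖
    filter_upwards [eventually_ge_atTop N] with n hn
    rw [SimpleFunc.restrict_apply _ (hB n), Set.indicator_of_mem]
    rw [mem_closedBall_zero_iff]
    exact hN.trans (by exact_mod_cast hn)
  · rw [SimpleFunc.restrict_apply _ (hB n)]
    by_cases hu : u ∈ Metric.closedBall (0 : EuclideanSpace ℝ (Fin d)) n
    · rw [Set.indicator_of_mem hu]; exact ha n u
    · rw [Set.indicator_of_notMem hu]; simp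

/-- A function in `L² ∩ L⁴` has an integral, whose fourth moment is given by the same formula as
for simple functions. -/
lemma IsLevyBasis.exists_isIntegral (hL : IsLevyBasis P L) {v κ : ℝ}
    (hM : HasMoments P L v κ) {f : EuclideanSpace ℝ (Fin d) → ℝ} (hf : Measurable f)
    (hf2 : MemLp f 2 volume) (hf4 : MemLp f 4 volume) :
    ∃ I, IsIntegral P L f I ∧ MemLp (I Set.univ) 4 P ∧
      ∫ ω, I Set.univ ω ^ 4 ∂P = κ * (∫ u, f u ^ 4) + 3 * v ^ 2 * (∫ u, f u ^ 2) ^ 2 := by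
  obtain ⟨g, hg, hgf, hgb⟩ := exists_simpleFunc_tendsto hf
  have hi2 : Integrable (fun u => |f u| ^ 2) volume := by simpa using hf2.integrable_sq
  have hi4 : Integrable (fun u => |f u| ^ 4) volume := by
    simpa [Even.pow_abs (show Even 4 by decide)] using (memLp_four_iff hf4.1).1 hf4
  have hdiff {k : ℕ} (hk : k ≠ 0) (hik : Integrable (fun u => |f u| ^ k) volume)
      (A : Set (EuclideanSpace ℝ (Fin d))) :
      Tendsto (fun p : ℕ × ℕ => ∫ u in A, linComb 1 (-1) (g p.1) (g p.2) u ^ k) atTop (𝓝 0) := by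
    rw [← integral_zero (EuclideanSpace ℝ (Fin d)) ℝ (μ := volume.restrict A)]
    refine tendsto_integral_filter_of_dominated_convergence (fun u => 4 ^ k * |f u| ^ k)
      (Eventually.of_forall fun p => (SimpleFunc.measurable _).pow_const k |>.aestronglyMeasurable)
      (Eventually.of_forall fun p => Eventually.of_forall fun u => ?_)
      (hik.const_mul _).restrict (Eventually.of_forall fun u => ?_)
    · rw [norm_pow, ← mul_pow]
      refine pow_le_pow_left₀ (norm_nonneg _) ?_ k
      have h1 := hgb p.1 u
      have h2 := hgb p.2 u
      rw [linComb_apply, Real.norm_eq_abs]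
      calc |1 * g p.1 u + -1 * g p.2 u| ≤ |1 * g p.1 u| + |-1 * g p.2 u| := abs_add_le _ _
        _ = |g p.1 u| + |g p.2 u| := by simp
        _ ≤ 4 * |f u| := by linarith
    · have h1 := ((hgf u).comp tendsto_fst).sub ((hgf u).comp tendsto_snd)
      rw [prod_atTop_atTop_eq, sub_self] at h1
      have h2 := h1.pow k
      rw [zero_pow hk] at h2
      refine h2.congr fun p => ?_
      simp [sub_eq_add_neg]
  have hsingle {k : ℕ} (hik : Integrable (fun u => |f u| ^ k) volume) :
      Tendsto (fun n => ∫ u, g n u ^ k) atTop (𝓝 (∫ u, f u ^ k)) := by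
    refine tendsto_integral_filter_of_dominated_convergence (fun u => 2 ^ k * |f u| ^ k)
      (Eventually.of_forall fun p => (SimpleFunc.measurable _).pow_const k |>.aestronglyMeasurable)
      (Eventually.of_forall fun n => Eventually.of_forall fun u => ?_)
      (hik.const_mul _) (Eventually.of_forall fun u => (hgf u).pow k)
    rw [norm_pow, ← mul_pow]
    exact pow_le_pow_left₀ (norm_nonneg _) (hgb n u) k
  have hmem (n) {A : Set (EuclideanSpace ℝ (Fin d))} (hA : MeasurableSet A) :
      MemLp (simpleIntegral L (g n) A) 4 P := hM.memLp_simpleIntegral (hg n) hA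
  have : Fact ((1 : ENNReal) ≤ 4) := ⟨by norm_num⟩
  -- Measurability is assumed inside the existential so that `choose` gives a family indexed by all
  -- sets; nonmeasurable ones receive `0`.
  have hex (A : Set (EuclideanSpace ℝ (Fin d))) : ∃ Z : Ω → ℝ, ∀ hA : MeasurableSet A,
      Measurable Z ∧ ∃ hZ : MemLp Z 4 P,
        Tendsto (fun n => (hmem n hA).toLp _) atTop (𝓝 (hZ.toLp Z)) := by
    by_cases hA : MeasurableSet A
    · have : Fact ((1 : ENNReal) ≤ 4) := ⟨by norm_num⟩
      have hc : CauchySeq fun n => (hmem n hA).toLp (simpleIntegral L (g n) A) := by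
        rw [cauchySeq_iff_tendsto_dist_atTop_0]
        have hdmem (p : ℕ × ℕ) := hM.memLp_simpleIntegral
          (isBounded_support_linComb 1 (-1) (hg p.1) (hg p.2)) hA
        have h1 := tendsto_eLpNorm_four_zero (l := atTop) hdmem (by
          simp_rw [fun p : ℕ × ℕ => hL.integral_simpleIntegral_pow_four hM
            (isBounded_support_linComb 1 (-1) (hg p.1) (hg p.2)) hA]
          simpa using ((hdiff (by norm_num) hi4 A).const_mul κ).add
            (((hdiff (by norm_num) hi2 A).pow 2).const_mul (3 * v ^ 2)))
        have h2 := (ENNReal.tendsto_toReal ENNReal.zero_ne_top).comp h1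
        refine h2.congr fun p => ?_
        rw [dist_eq_norm, ← MemLp.toLp_sub, Lp.norm_toLp, Function.comp_apply]
        congr 1
        refine eLpNorm_congr_ae ?_
        filter_upwards [hL.simpleIntegral_linComb 1 (-1) (hg p.1) (hg p.2) hA] with ω hω
        rw [hω, Pi.sub_apply]; ring
      obtain ⟨Z, hZ⟩ := cauchySeq_tendsto_of_complete hc
      refine ⟨Z, fun _ => ⟨(Lp.stronglyMeasurable Z).measurable, Lp.memLp Z, ?_⟩⟩
      rwa [Lp.toLp_coeFn]
    · exact ⟨0, fun h => absurd h hA⟩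
  choose I hI using hex
  refine ⟨I, ⟨g, hg, Eventually.of_forall hgf, fun A hA => ⟨(hI A hA).1, ?_⟩⟩, ?_⟩
  · obtain ⟨-, hZ, hlim⟩ := hI A hA
    exact (tendstoInMeasure_of_tendsto_Lp hlim).congr (fun n => MemLp.coeFn_toLp _)
      (MemLp.coeFn_toLp _)
  · obtain ⟨-, hZ, hlim⟩ := hI Set.univ .univ
    refine ⟨hZ, ?_⟩
    -- The fourth moment is the fourth power of the `L⁴` norm, hence passes to the limit.
    have h1 := hlim.norm.pow 4
    simp only [norm_toLp_four_pow] at h1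
    simp_rw [fun n => hL.integral_simpleIntegral_pow_four hM (hg n) .univ,
      Measure.restrict_univ] at h1
    exact tendsto_nhds_unique h1
      (((hsingle hi4).const_mul κ).add (((hsingle hi2).pow 2).const_mul (3 * v ^ 2)))

/-- The fourth moment of an arbitrary integral of a function in `L² ∩ L⁴`. -/
lemma IsLevyBasis.integral_pow_four_of_isIntegral (hL : IsLevyBasis P L) {v κ : ℝ}
    (hM : HasMoments P L v κ) {f : EuclideanSpace ℝ (Fin d) → ℝ} (hf : Measurable f)
    (hf2 : MemLp f 2 volume) (hf4 : MemLp f 4 volume)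
    {I : Set (EuclideanSpace ℝ (Fin d)) → Ω → ℝ} (hI : IsIntegral P L f I) :
    Integrable (fun ω => I Set.univ ω ^ 4) P ∧
      ∫ ω, I Set.univ ω ^ 4 ∂P = κ * (∫ u, f u ^ 4) + 3 * v ^ 2 * (∫ u, f u ^ 2) ^ 2 := by
  obtain ⟨J, hJ, hJ4, hJe⟩ := hL.exists_isIntegral hM hf hf2 hf4
  have hIJ := hL.isIntegral_unique hM hI hJ
  have hI4 : MemLp (I Set.univ) 4 P := hJ4.ae_eq hIJ.symm
  refine ⟨(memLp_four_iff hI4.1).1 hI4, ?_⟩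
  rw [← hJe]
  refine integral_congr_ae ?_
  filter_upwards [hIJ] with ω hω
  rw [hω]

end

/-! ### Polarization -/

/-- The sign vectors `(1, ±1, ±1, ±1)`. -/
def signVec (p : Fin 2 × Fin 2 × Fin 2) : Fin 4 → ℝ :=
  ![1, (-1) ^ (p.1 : ℕ), (-1) ^ (p.2.1 : ℕ), (-1) ^ (p.2.2 : ℕ)]

/-- Summing over signs kills each monomial unless `x 1`, `x 2`, `x 3` have odd exponents, which in
degree `4` leaves only `∏ x i`; `192 = 8 * 4!`. The first sign can be fixed since a global sign
change alters nothing. -/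
lemma sum_signVec_pow_four (x : Fin 4 → ℝ) :
    ∑ p, (∏ i, signVec p i) * (∑ i, signVec p i * x i) ^ 4 = 192 * ∏ i, x i := by
  simp only [Fintype.sum_prod_type, Fin.sum_univ_two, Fin.sum_univ_four, Fin.prod_univ_four,
    signVec]
  simp
  ring

/-- Only terms with four distinct indices survive; each pairing arises from `8` orderings and there
are `8` sign vectors. -/
lemma sum_signVec_sq_sq (G : Fin 4 → Fin 4 → ℝ) (hG : ∀ i j, G i j = G j i) :
    ∑ p, (∏ i, signVec p i) * (∑ i, ∑ j, signVec p i * signVec p j * G i j) ^ 2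
      = 64 * (G 0 1 * G 2 3 + G 0 2 * G 1 3 + G 0 3 * G 1 2) := by
  simp only [Fintype.sum_prod_type, Fin.sum_univ_two, Fin.sum_univ_four, Fin.prod_univ_four,
    signVec]
  rw [hG 1 0, hG 2 0, hG 3 0, hG 2 1, hG 3 1, hG 3 2]
  simp
  ring

section

variable {d : ℕ} {Ω : Type*} [MeasurableSpace Ω] {P : Measure Ω} [IsProbabilityMeasure P]
  {L : Set (EuclideanSpace ℝ (Fin d)) → Ω → ℝ}

lemma IsLevyBasis.isIntegral_sum (hL : IsLevyBasis P L)
    {f : Fin 4 → EuclideanSpace ℝ (Fin d) → ℝ} {I : Fin 4 → Set (EuclideanSpace ℝ (Fin d)) → Ω → ℝ}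
    (hI : ∀ i, IsIntegral P L (f i) (I i)) (c : Fin 4 → ℝ) :
    IsIntegral P L (fun u => ∑ i, c i * f i u) (fun A ω => ∑ i, c i * I i A ω) := by
  have h := hL.isIntegral_linComb 1 (c 3) (hL.isIntegral_linComb 1 (c 2)
    (hL.isIntegral_linComb (c 0) (c 1) (hI 0) (hI 1)) (hI 2)) (hI 3)
  simpa only [one_mul, Fin.sum_univ_four] using h

end

end LevyNoise

/-! ### The fourth order product formula -/

open LevyNoise in
theorem proposition6p1 {d : ℕ} {Ω : Type*} [MeasurableSpace Ω] (P : Measure Ω)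
    [IsProbabilityMeasure P] (L : Set (EuclideanSpace ℝ (Fin d)) → Ω → ℝ)
    (hL : LevyNoise.IsLevyBasis P L)
    (hL4 : Integrable (fun ω => L (LevyNoise.unitCube d) ω ^ 4) P)
    (hL1 : ∫ ω, L (LevyNoise.unitCube d) ω ∂P = 0)
    (σ η : ℝ) (hσ : 0 < σ) (hσL : σ ^ 2 = ∫ ω, L (LevyNoise.unitCube d) ω ^ 2 ∂P)
    (hη : η = (σ ^ 4)⁻¹ * ∫ ω, L (LevyNoise.unitCube d) ω ^ 4 ∂P)
    (f : Fin 4 → EuclideanSpace ℝ (Fin d) → ℝ) (hf : ∀ i, Measurable (f i))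
    (hf2 : ∀ i, MemLp (f i) 2 volume) (hf4 : ∀ i, MemLp (f i) 4 volume) :
    (∀ i, LevyNoise.IsIntegrable P L (f i)) ∧
    ∀ I : Fin 4 → Set (EuclideanSpace ℝ (Fin d)) → Ω → ℝ,
      (∀ i, LevyNoise.IsIntegral P L (f i) (I i)) →
      Integrable (fun ω => ∏ i, I i Set.univ ω) P ∧
      ∫ ω, ∏ i, I i Set.univ ω ∂P
        = (η - 3) * σ ^ 4 * (∫ u, f 0 u * f 1 u * f 2 u * f 3 u)
          + σ ^ 4 * (∫ u, f 0 u * f 1 u) * (∫ u, f 2 u * f 3 u)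
          + σ ^ 4 * (∫ u, f 0 u * f 2 u) * (∫ u, f 1 u * f 3 u)
          + σ ^ 4 * (∫ u, f 0 u * f 3 u) * (∫ u, f 1 u * f 2 u) := by
  have hmQ : Measurable (L (unitCube d)) := hL.measurable _ (measurableSet_box _) (isBounded_box _)
  have hM := hL.hasMoments ((memLp_four_iff hmQ.aestronglyMeasurable).2 hL4) hL1
  have hκ : ∫ ω, L (unitCube d) ω ^ 4 ∂P - 3 * (∫ ω, L (unitCube d) ω ^ 2 ∂P) ^ 2
      = (η - 3) * σ ^ 4 := by
    rw [hη, ← hσL]; field_simp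
  rw [hκ, ← hσL] at hM
  refine ⟨fun i => ?_, fun I hI => ?_⟩
  · obtain ⟨J, hJ, -⟩ := hL.exists_isIntegral hM (hf i) (hf2 i) (hf4 i)
    exact ⟨J, hJ⟩
  have hF2 (c : Fin 4 → ℝ) : MemLp (fun u => ∑ i, c i * f i u) 2 volume :=
    memLp_finsetSum _ fun i _ => (hf2 i).const_mul _
  have hF4 (c : Fin 4 → ℝ) : MemLp (fun u => ∑ i, c i * f i u) 4 volume :=
    memLp_finsetSum _ fun i _ => (hf4 i).const_mul _
  have hmom (c : Fin 4 → ℝ) := hL.integral_pow_four_of_isIntegral hM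
    (Finset.measurable_sum _ fun i _ => (hf i).const_mul (c i)) (hF2 c) (hF4 c)
    (hL.isIntegral_sum hI c)
  have hpol (ω : Ω) : ∏ i, I i Set.univ ω = 192⁻¹ * ∑ p, (∏ i, signVec p i) *
      (∑ i, signVec p i * I i Set.univ ω) ^ 4 := by
    rw [sum_signVec_pow_four]; ring
  have hint : Integrable (fun ω => ∑ p, (∏ i, signVec p i) *
      (∑ i, signVec p i * I i Set.univ ω) ^ 4) P :=
    integrable_finsetSum _ fun p _ => (hmom _).1.const_mul _
  have hfour : ∑ p, (∏ i, signVec p i) * ∫ u, (∑ i, signVec p i * f i u) ^ 4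
      = 192 * ∫ u, f 0 u * f 1 u * f 2 u * f 3 u := by
    simp_rw [← integral_const_mul]
    rw [← integral_finsetSum _ fun p _ => ((memLp_four_iff (hF4 _).1).1 (hF4 _)).const_mul _]
    refine integral_congr_ae (Eventually.of_forall fun u => ?_)
    exact (sum_signVec_pow_four fun i => f i u).trans (by rw [Fin.prod_univ_four])
  have hG (i j) : Integrable (fun u => f i u * f j u) volume := (hf2 i).integrable_mul (hf2 j)
  have htwo (c : Fin 4 → ℝ) : ∫ u, (∑ i, c i * f i u) ^ 2
      = ∑ i, ∑ j, c i * c j * ∫ u, f i u * f j u := by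
    simp_rw [← integral_const_mul]
    simp_rw [← fun i => integral_finsetSum Finset.univ
      fun j _ => (hG i j).const_mul (c i * c j)]
    rw [← integral_finsetSum _ fun i _ => integrable_finsetSum _
      fun j _ => (hG i j).const_mul (c i * c j)]
    refine integral_congr_ae (Eventually.of_forall fun u => ?_)
    simp only [sq, Finset.sum_mul_sum]
    exact Finset.sum_congr rfl fun i _ => Finset.sum_congr rfl fun j _ => by ring
  have hsq := sum_signVec_sq_sq (fun i j => ∫ u, f i u * f j u)
    fun i j => by simp only [mul_comm]
  simp_rw [hpol]
  refine ⟨hint.const_mul _, ?_⟩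
  rw [integral_const_mul, integral_finsetSum _ fun p _ => (hmom _).1.const_mul _]
  simp_rw [integral_const_mul, fun p => (hmom (signVec p)).2, htwo, mul_add,
    Finset.sum_add_distrib, mul_left_comm (∏ i, signVec _ i), ← Finset.mul_sum]
  -- The constants match: `192 / 192 = 1` for the cumulant term and `3 * 64 / 192 = 1` for each
  -- pairing.
  rw [hfour, hsq]
  ring
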